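/- Let $P\subset\mathbb{R}^2$ be the closed region bounded by a simple polygon with $n$ vertices ($n\ge 3$; the boundary $\partial P$, the union of the $n$ edges, is a closed polygonal curve without self-intersections, and $P$ consists of $\partial P$ together with the points enclosed by it). For $x\in P$ let $\mathrm{VP}(P,x)=\{g\in P : \text{the segment } [x,g] \text{ is contained in } P\}$ be the visibility polygon of $x$, and for an arbitrary (finite or infinite) set $S\subseteq P$ let $$F(S)=P\cap\bigcap_{x\in S}\mathrm{VP}(P,x)$$ be its feasible region. A vertex of $F(S)$ is a point $p\in\partial F(S)$ such that in no neighbourhood of $p$ does $\partial F(S)$ coincide with a straight line through $p$. Then, for every $S\subseteq P$, the feasible region $F(S)$ has only finitely many vertices, and in fact at most $3n$ of them; in particular, it has $O(n)$ vertices. -/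

import Mathlib

open scoped Topology

/-- The Euclidean plane. -/
abbrev Plane : Type := EuclideanSpace ℝ (Fin 2)

/-- A polygon with vertices `v₀, …, vₙ₋₁` and edges `[vᵢ, vᵢ₊₁]` (indices modulo `n`) is simple if
its boundary is a closed curve without self-intersections: there are at least three vertices, they
are pairwise distinct, and two different edges meet at most in an endpoint which they share as
consecutive edges. (Here `finRotate n i` is the index `i + 1` modulo `n`.) -/
structure Polygon.IsSimple {n : ℕ} (poly : Polygon Plane n) : Prop where
  three_le : 3 ≤ n
  injective : Function.Injective poly.vertices
  edge_inter : ∀ i j : Fin n, i ≠ j → ∀ x : Plane, x ∈ poly.edgeSet ℝ i → x ∈ poly.edgeSet ℝ j →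
    (j = finRotate n i ∧ x = poly j) ∨ (i = finRotate n j ∧ x = poly i)

/-- The closed region `P` bounded by a polygon: the boundary curve together with all points it
encloses, i.e. the points whose connected component in the complement of the curve is bounded. -/
def Polygon.region {n : ℕ} (poly : Polygon Plane n) : Set Plane :=
  {x | x ∈ poly.boundary ℝ ∨
    Bornology.IsBounded (connectedComponentIn (poly.boundary ℝ)ᶜ x)}

/-- The visibility polygon of `x`: all points `g` of the closed region `P` such that the whole line
segment from `x` to `g` is contained in `P`. -/
def Polygon.visibilityPolygon {n : ℕ} (poly : Polygon Plane n) (x : Plane) : Set Plane :=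
  {g | g ∈ poly.region ∧ segment ℝ x g ⊆ poly.region}

/-- The feasible region of `S`: all points of `P` that see every point of `S`. -/
def Polygon.feasibleRegion {n : ℕ} (poly : Polygon Plane n) (S : Set Plane) : Set Plane :=
  poly.region ∩ ⋂ x ∈ S, poly.visibilityPolygon x

/-- `p` is a vertex of the plane set `A` if it is a boundary point of `A` at which the boundary
of `A` is not straight, i.e. in no neighbourhood of `p` does the boundary of `A` coincide with a
line through `p`. This also makes sense for degenerate polygonal sets: corners,
tips and base points of one-dimensional parts, points where `A` touches itself, and isolated
points are vertices. A bounded closed set with finitely many vertices has a boundary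
consisting of finitely many segments and points. -/
def IsVertexOf (A : Set Plane) (p : Plane) : Prop :=
  p ∈ frontier A ∧
    ¬ ∃ d : Plane, d ≠ 0 ∧ ∀ᶠ q in 𝓝 p, (q ∈ frontier A ↔ ∃ t : ℝ, q = p + t • d)

/-!
The feasible region `F` of `S` is bounded by pieces of few lines, and its vertices are counted
by double counting. A carrier is one of `3 * n` sets of collinear points of `F`: for each edge, the
part of the edge in `F`; for each polygon vertex `v` and each of the two sides of a line of sight,
the set of points of `F` at which `v` supports `F` on that side, i.e. near which the view from `S`
past `v` is blocked by `v` on that side (`carrier`, `IsSupport`). A set of collinear points has at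
most two extreme points, and every vertex of `F` is an extreme point of at least two carriers
(`exists_two_carriers_of_isVertexOf`). Hence twice the number of vertices is at most `2 * (3 * n)`.

The Jordan curve theorem is not needed; the following facts about the region `P` suffice.

* `P` is closed, its frontier lies on the boundary curve, and a triangle whose sides lie in `P` is
  contained in `P`, because the component of a point outside `P` is unbounded
  (`segment_subset_region_of_triangle`). So `F` contains each segment in `P` with both ends in `F`.
* `P` is conic near every point. Near each of its points that is not a polygon vertex it consists of
  a line and some of the two sides of the line (`exists_isLinearAt`), and near a polygon vertex the
  boundary curve lies on two rays (`exists_boundary_subset_two_rays`).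

If `x` sees `p` but not the nearby point `p + u`, then the last point of `[p, p + u]` seen by `x` is
seen past a blocking polygon vertex (`exists_isBlocking`); conversely `F` lies locally on one side
of each line that supports it at `p` (`IsSupport.side_mul_cross_nonpos`). Therefore, near a point
`p` that is not a polygon vertex, `F` is the part of `P` cut out by the supporting lines at `p`. If
they all coincide, with the line of the edge in case `p` lies on the frontier of `P`, then the
frontier of `F` is straight at `p` (`not_isVertexOf_of_isSupport`). So at a vertex of `F` in the
interior of `P` there are two different supporting lines, and at a vertex of `F` on an edge there is
one that crosses the edge; in both cases each of the two lines makes `p` extreme in the carrier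
along the other one. A polygon vertex is extreme in the two edges that end there.

The points that `v` supports on one side are collinear with `v`
(`IsSupport.cross_eq_zero_of_isSupport`): otherwise a line through `v` would run inside `P` near
`v` with points of the complement arbitrarily close to `v` on both sides of it. On each side, both
rays of the boundary at `v` would be needed to separate these points from the line.
-/

namespace PolygonVisibility

/-! ### The cross product of plane vectors -/

/-- The cross product (signed area) of two plane vectors: it is positive when `b` points to the left
of `a`. -/
def cross (a b : Plane) : ℝ := a 0 * b 1 - a 1 * b 0

lemma cross_add_right (a b c : Plane) : cross a (b + c) = cross a b + cross a c := by
  simp [cross]; ring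

lemma cross_add_left (a b c : Plane) : cross (a + b) c = cross a c + cross b c := by
  simp [cross]; ring

lemma cross_sub_right (a b c : Plane) : cross a (b - c) = cross a b - cross a c := by
  simp [cross]; ring

lemma cross_sub_left (a b c : Plane) : cross (a - b) c = cross a c - cross b c := by
  simp [cross]; ring

lemma cross_smul_right (a b : Plane) (t : ℝ) : cross a (t • b) = t * cross a b := by
  simp [cross]; ring

lemma cross_smul_left (a b : Plane) (t : ℝ) : cross (t • a) b = t * cross a b := by
  simp [cross]; ring

lemma cross_neg_right (a b : Plane) : cross a (-b) = -cross a b := by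
  simp [cross]; ring

lemma cross_neg_left (a b : Plane) : cross (-a) b = -cross a b := by
  simp [cross]; ring

@[simp] lemma cross_self (a : Plane) : cross a a = 0 := by
  simp [cross]; ring

@[simp] lemma cross_zero_right (a : Plane) : cross a 0 = 0 := by
  simp [cross]

@[simp] lemma cross_zero_left (a : Plane) : cross 0 a = 0 := by
  simp [cross]

lemma cross_swap (a b : Plane) : cross b a = -cross a b := by
  simp [cross]; ring

@[fun_prop]
lemma continuous_cross {X : Type*} [TopologicalSpace X] {f g : X → Plane} (hf : Continuous f)
    (hg : Continuous g) : Continuous fun x => cross (f x) (g x) := by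
  unfold cross; fun_prop

/-- Cramer's rule in the plane. -/
lemma eq_smul_add_smul_of_cross_ne_zero {a b : Plane} (h : cross a b ≠ 0) (m : Plane) :
    m = (cross m b / cross a b) • a + (cross a m / cross a b) • b := by
  ext i
  fin_cases i
  · simp only [Fin.zero_eta, PiLp.add_apply, PiLp.smul_apply, smul_eq_mul]
    field_simp
    simp only [cross]; ring
  · simp only [Fin.mk_one, PiLp.add_apply, PiLp.smul_apply, smul_eq_mul]
    field_simp
    simp only [cross]; ring

lemma exists_smul_of_cross_eq_zero {w u : Plane} (hw : w ≠ 0) (h : cross w u = 0) :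
    ∃ t : ℝ, u = t • w := by
  have hs : 0 < w 0 ^ 2 + w 1 ^ 2 := by
    by_contra hc
    apply hw
    have h0 : w 0 = 0 := by nlinarith [sq_nonneg (w 0), sq_nonneg (w 1)]
    have h1 : w 1 = 0 := by nlinarith [sq_nonneg (w 0), sq_nonneg (w 1)]
    ext i
    fin_cases i <;> simp [h0, h1]
  refine ⟨(w 0 * u 0 + w 1 * u 1) / (w 0 ^ 2 + w 1 ^ 2), ?_⟩
  simp only [cross] at h
  ext i
  fin_cases i
  · simp only [Fin.zero_eta, PiLp.smul_apply, smul_eq_mul]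
    field_simp
    linear_combination (-w 1) * h
  · simp only [Fin.mk_one, PiLp.smul_apply, smul_eq_mul]
    field_simp
    linear_combination (w 0) * h

lemma exists_smul_iff_cross_eq_zero {w u : Plane} (hw : w ≠ 0) :
    (∃ t : ℝ, u = t • w) ↔ cross w u = 0 := by
  refine ⟨?_, exists_smul_of_cross_eq_zero hw⟩
  rintro ⟨t, rfl⟩
  rw [cross_smul_right, cross_self, mul_zero]

/-! ### Segments -/

lemma mem_segment_iff_exists_smul {x y z : Plane} :
    z ∈ segment ℝ x y ↔ ∃ t : ℝ, 0 ≤ t ∧ t ≤ 1 ∧ z = x + t • (y - x) := by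
  rw [segment_eq_image']
  constructor
  · rintro ⟨t, ⟨h0, h1⟩, rfl⟩; exact ⟨t, h0, h1, rfl⟩
  · rintro ⟨t, h0, h1, rfl⟩; exact ⟨t, ⟨h0, h1⟩, rfl⟩

lemma mem_openSegment_iff_exists_smul {x y z : Plane} :
    z ∈ openSegment ℝ x y ↔ ∃ t : ℝ, 0 < t ∧ t < 1 ∧ z = x + t • (y - x) := by
  rw [openSegment_eq_image']
  constructor
  · rintro ⟨t, ⟨h0, h1⟩, rfl⟩; exact ⟨t, h0, h1, rfl⟩
  · rintro ⟨t, h0, h1, rfl⟩; exact ⟨t, ⟨h0, h1⟩, rfl⟩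

/-- Visibility is a closed condition in both ends of the segment. -/
lemma isClosed_setOf_segment_subset {A : Set Plane} (hA : IsClosed A) :
    IsClosed {q : Plane × Plane | segment ℝ q.1 q.2 ⊆ A} := by
  have : {q : Plane × Plane | segment ℝ q.1 q.2 ⊆ A}
      = ⋂ t ∈ Set.Icc (0 : ℝ) 1, {q : Plane × Plane | q.1 + t • (q.2 - q.1) ∈ A} := by
    ext q
    simp only [Set.mem_ofPred_eq, Set.mem_iInter, segment_eq_image', Set.image_subset_iff]
    rfl
  rw [this]
  exact isClosed_biInter fun t _ => hA.preimage (by fun_prop)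

/-- Of the three sides of a degenerate triangle, the longest contains the others. -/
lemma segment_subset_union_of_collinear {x p q : Plane} (h : Collinear ℝ {x, p, q}) :
    segment ℝ p q ⊆ segment ℝ x p ∪ segment ℝ x q := by
  rcases h.wbtw_or_wbtw_or_wbtw with h | h | h
  · have hp : p ∈ segment ℝ x q := mem_segment_iff_wbtw.2 h
    exact ((convex_segment x q).segment_subset hp (right_mem_segment ℝ x q)).trans
      Set.subset_union_right
  · have hp : q ∈ segment ℝ x p := by rw [segment_symm]; exact mem_segment_iff_wbtw.2 h
    exact ((convex_segment x p).segment_subset (right_mem_segment ℝ x p) hp).trans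
      Set.subset_union_left
  · have hx : x ∈ segment ℝ p q := by rw [segment_symm]; exact mem_segment_iff_wbtw.2 h
    obtain ⟨r, ⟨hr0, hr1⟩, rfl⟩ := mem_segment_iff_wbtw.1 hx
    intro z hz
    obtain ⟨s, ⟨hs0, hs1⟩, rfl⟩ := mem_segment_iff_wbtw.1 hz
    rcases le_total s r with hsr | hsr
    · left
      have : s ∈ segment ℝ r 0 := by
        rw [segment_symm, segment_eq_Icc hr0]; exact ⟨hs0, hsr⟩
      have := Set.mem_image_of_mem (AffineMap.lineMap p q : ℝ →ᵃ[ℝ] Plane) this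
      rwa [image_segment, AffineMap.lineMap_apply_zero] at this
    · right
      have : s ∈ segment ℝ r 1 := by
        rw [segment_eq_Icc hr1]; exact ⟨hsr, hs1⟩
      have := Set.mem_image_of_mem (AffineMap.lineMap p q : ℝ →ᵃ[ℝ] Plane) this
      rwa [image_segment, AffineMap.lineMap_apply_one] at this

lemma collinear_of_cross_eq_zero {x p q : Plane} (h : cross (p - x) (q - x) = 0) :
    Collinear ℝ {x, p, q} := by
  by_cases hp : p - x = 0
  · rw [sub_eq_zero.1 hp]; simpa using collinear_pair ℝ x q
  · obtain ⟨t, ht⟩ := exists_smul_of_cross_eq_zero hp h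
    rw [collinear_iff_of_mem (p₀ := x) (by simp)]
    refine ⟨p - x, ?_⟩
    simp only [Set.mem_insert_iff, Set.mem_singleton_iff, vadd_eq_add]
    rintro y (rfl | rfl | rfl)
    · exact ⟨0, by simp⟩
    · exact ⟨1, by simp⟩
    · exact ⟨t, by rw [← ht]; simp⟩

/-! ### The closed region bounded by a polygon -/

section Region

variable {n : ℕ} (poly : Polygon Plane n)

lemma edgeSet_eq_segment (i : Fin n) :
    poly.edgeSet ℝ i = segment ℝ (poly i) (poly (finRotate n i)) := by
  rw [Polygon.edgeSet, affineSegment_eq_segment]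

lemma isCompact_edgeSet (i : Fin n) : IsCompact (poly.edgeSet ℝ i) := by
  rw [edgeSet_eq_segment, segment_eq_image']
  exact isCompact_Icc.image (by fun_prop)

lemma mem_boundary_iff {x : Plane} : x ∈ poly.boundary ℝ ↔ ∃ i, x ∈ poly.edgeSet ℝ i := by
  simp [Polygon.boundary]

lemma isClosed_boundary : IsClosed (poly.boundary ℝ) :=
  (isCompact_iUnion fun i => isCompact_edgeSet poly i).isClosed

lemma boundary_subset_region : poly.boundary ℝ ⊆ poly.region := fun _ hx => Or.inl hx

lemma edgeSet_subset_region (i : Fin n) : poly.edgeSet ℝ i ⊆ poly.region := fun _ hx =>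
  Or.inl ((mem_boundary_iff poly).2 ⟨i, hx⟩)

lemma mem_region_iff_of_isPreconnected {A : Set Plane} (hA : IsPreconnected A)
    (hAC : A ⊆ (poly.boundary ℝ)ᶜ) {x y : Plane} (hx : x ∈ A) (hy : y ∈ A) :
    x ∈ poly.region ↔ y ∈ poly.region := by
  have h : y ∈ connectedComponentIn (poly.boundary ℝ)ᶜ x :=
    hA.subset_connectedComponentIn hx hAC hy
  have hx' : x ∉ poly.boundary ℝ := hAC hx
  have hy' : y ∉ poly.boundary ℝ := hAC hy
  simp only [Polygon.region, Set.mem_ofPred_eq, hx', hy', false_or, connectedComponentIn_eq h]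

lemma isClosed_region : IsClosed poly.region := by
  rw [← isOpen_compl_iff, isOpen_iff_mem_nhds]
  intro x hx
  have hxC : x ∈ (poly.boundary ℝ)ᶜ := fun h => hx (boundary_subset_region poly h)
  have hopen : IsOpen (connectedComponentIn (poly.boundary ℝ)ᶜ x) :=
    (isClosed_boundary poly).isOpen_compl.connectedComponentIn
  have hxx := mem_connectedComponentIn hxC
  filter_upwards [hopen.mem_nhds hxx] with y hy
  exact fun h => hx ((mem_region_iff_of_isPreconnected poly isPreconnected_connectedComponentIn
    (connectedComponentIn_subset _ _) hxx hy).2 h)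

lemma frontier_region_subset : frontier poly.region ⊆ poly.boundary ℝ := by
  intro x hx
  rw [(isClosed_region poly).frontier_eq] at hx
  by_contra hc
  apply hx.2
  have hxC : x ∈ (poly.boundary ℝ)ᶜ := hc
  have hopen : IsOpen (connectedComponentIn (poly.boundary ℝ)ᶜ x) :=
    (isClosed_boundary poly).isOpen_compl.connectedComponentIn
  have hxx := mem_connectedComponentIn hxC
  rw [mem_interior_iff_mem_nhds]
  filter_upwards [hopen.mem_nhds hxx] with y hy
  exact (mem_region_iff_of_isPreconnected poly isPreconnected_connectedComponentIn
    (connectedComponentIn_subset _ _) hxx hy).1 hx.1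

variable {poly}

/-- A triangle whose three sides lie in the region is contained in the region: the component of a
point outside the region is connected and unbounded, so it cannot stay within the sides. -/
lemma segment_subset_region_of_triangle {x p q r : Plane} (hxp : segment ℝ x p ⊆ poly.region)
    (hxq : segment ℝ x q ⊆ poly.region) (hpq : segment ℝ p q ⊆ poly.region)
    (hr : r ∈ segment ℝ p q) : segment ℝ x r ⊆ poly.region := by
  by_cases hD : cross (p - x) (q - x) = 0
  · have hcol := collinear_of_cross_eq_zero hD
    -- a degenerate triangle is one of its sides
    have key : ∀ {a c : Plane}, segment ℝ a c ⊆ poly.region →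
        x ∈ segment ℝ a c → p ∈ segment ℝ a c → q ∈ segment ℝ a c →
        segment ℝ x r ⊆ poly.region := by
      intro a c hac hx hp hq
      exact ((convex_segment a c).segment_subset hx
        ((convex_segment a c).segment_subset hp hq hr)).trans hac
    rcases hcol.wbtw_or_wbtw_or_wbtw with h | h | h
    · exact key hxq (left_mem_segment ℝ _ _) (mem_segment_iff_wbtw.2 h)
        (right_mem_segment ℝ _ _)
    · exact key (by rwa [segment_symm]) (right_mem_segment ℝ _ _) (left_mem_segment ℝ _ _)
        (mem_segment_iff_wbtw.2 h)
    · exact key (by rwa [segment_symm]) (mem_segment_iff_wbtw.2 h) (right_mem_segment ℝ _ _)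
        (left_mem_segment ℝ _ _)
  · intro y hy
    by_contra hyP
    set α : Plane → ℝ := fun z => cross (z - x) (q - x) / cross (p - x) (q - x) with hα
    set β : Plane → ℝ := fun z => cross (p - x) (z - x) / cross (p - x) (q - x) with hβ
    have hαc : Continuous α := by simp only [hα]; fun_prop
    have hβc : Continuous β := by simp only [hβ]; fun_prop
    have hz : ∀ z, z = x + (α z • (p - x) + β z • (q - x)) := fun z => by
      have := eq_smul_add_smul_of_cross_ne_zero hD (z - x)
      rw [← this]; abel
    have hyC : y ∈ (poly.boundary ℝ)ᶜ := fun h => hyP (boundary_subset_region poly h)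
    set U := connectedComponentIn (poly.boundary ℝ)ᶜ y with hU
    have hyU : y ∈ U := mem_connectedComponentIn hyC
    have hUP : ∀ z ∈ U, z ∉ poly.region := fun z hz h => hyP
      ((mem_region_iff_of_isPreconnected poly isPreconnected_connectedComponentIn
        (connectedComponentIn_subset _ _) hyU hz).2 h)
    have hside : ∀ z ∈ U, α z ≠ 0 ∨ (β z < 0 ∨ 1 < β z) := by
      intro z hzU
      by_contra! h
      refine hUP z hzU (hxq (mem_segment_iff_exists_smul.2 ⟨β z, h.2.1, h.2.2, ?_⟩))
      conv_lhs => rw [hz z, h.1]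
      simp
    have hside2 : ∀ z ∈ U, β z ≠ 0 ∨ (α z < 0 ∨ 1 < α z) := by
      intro z hzU
      by_contra! h
      refine hUP z hzU (hxp (mem_segment_iff_exists_smul.2 ⟨α z, h.2.1, h.2.2, ?_⟩))
      conv_lhs => rw [hz z, h.1]
      simp
    have hside3 : ∀ z ∈ U, α z + β z ≠ 1 ∨ (β z < 0 ∨ 1 < β z) := by
      intro z hzU
      by_contra! h
      refine hUP z hzU (hpq (mem_segment_iff_exists_smul.2 ⟨β z, h.2.1, h.2.2, ?_⟩))
      conv_lhs => rw [hz z, eq_sub_of_add_eq h.1]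
      module
    set T : Set Plane := {z | 0 < α z ∧ 0 < β z ∧ α z + β z < 1} with hT
    set O : Set Plane := {z | α z < 0 ∨ β z < 0 ∨ 1 < α z + β z} with hO
    have hTo : IsOpen T := by
      apply (isOpen_lt continuous_const hαc).inter
      exact (isOpen_lt continuous_const hβc).inter (isOpen_lt (hαc.add hβc) continuous_const)
    have hOo : IsOpen O := by
      apply (isOpen_lt hαc continuous_const).union
      exact (isOpen_lt hβc continuous_const).union (isOpen_lt continuous_const (hαc.add hβc))
    have hdisj : Disjoint T O := by
      rw [Set.disjoint_left]
      rintro z ⟨h1, h2, h3⟩ (h | h | h) <;> linarith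
    have hcov : U ⊆ T ∪ O := by
      intro z hzU
      by_contra hc
      simp only [hT, hO, Set.mem_union, Set.mem_ofPred_eq, not_or, not_and, not_lt] at hc
      obtain ⟨h1, h2, h3, h4⟩ := hc
      rcases hside z hzU with h | h | h
      · rcases hside2 z hzU with h' | h' | h'
        · rcases hside3 z hzU with h'' | h'' | h''
          · have := h1 (lt_of_le_of_ne h2 (Ne.symm h)) (lt_of_le_of_ne h3 (Ne.symm h'))
            exact h'' (le_antisymm h4 this)
          · linarith
          · linarith
        · linarith
        · linarith
      · linarith
      · linarith
    have hyT : y ∈ T := by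
      rcases hcov hyU with h | h
      · exact h
      · exfalso
        obtain ⟨s, hs0, hs1, rfl⟩ := mem_segment_iff_exists_smul.1 hr
        obtain ⟨t, ht0, ht1, rfl⟩ := mem_segment_iff_exists_smul.1 hy
        have e : x + t • (p + s • (q - p) - x) - x
          = (t * (1 - s)) • (p - x) + (t * s) • (q - x) := by module
        have ha : α (x + t • (p + s • (q - p) - x)) = t * (1 - s) := by
          simp only [hα, e, cross_add_left, cross_smul_left, cross_self]
          field_simp; ring
        have hb : β (x + t • (p + s • (q - p) - x)) = t * s := by
          simp only [hβ, e, cross_add_right, cross_smul_right, cross_self]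
          field_simp; ring
        simp only [hO, Set.mem_ofPred_eq, ha, hb] at h
        rcases h with h | h | h <;> nlinarith
    have hUT : U ⊆ T := isPreconnected_connectedComponentIn.subset_left_of_subset_union hTo hOo
      hdisj hcov ⟨y, hyU, hyT⟩
    apply hyP
    right
    refine (Metric.isBounded_closedBall (x := x) (r := ‖p - x‖ + ‖q - x‖)).subset ?_
    intro z hzU
    obtain ⟨h1, h2, h3⟩ := hUT hzU
    rw [mem_closedBall_iff_norm]
    have : z - x = α z • (p - x) + β z • (q - x) := by
      conv_lhs => rw [hz z]
      abel
    rw [this]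
    refine (norm_add_le _ _).trans ?_
    rw [norm_smul, norm_smul, Real.norm_of_nonneg h1.le, Real.norm_of_nonneg h2.le]
    have := norm_nonneg (p - x)
    have := norm_nonneg (q - x)
    gcongr <;> nlinarith

end Region

/-! ### Feasible regions -/

section Feasible

variable {n : ℕ} {poly : Polygon Plane n} {S : Set Plane}

lemma mem_feasibleRegion_iff {g : Plane} : g ∈ poly.feasibleRegion S ↔
    g ∈ poly.region ∧ ∀ x ∈ S, segment ℝ x g ⊆ poly.region := by
  simp only [Polygon.feasibleRegion, Polygon.visibilityPolygon, Set.mem_inter_iff, Set.mem_iInter,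
    Set.mem_ofPred_eq]
  exact ⟨fun h => ⟨h.1, fun x hx => (h.2 x hx).2⟩, fun h => ⟨h.1, fun x hx => ⟨h.1, h.2 x hx⟩⟩⟩

lemma feasibleRegion_subset_region : poly.feasibleRegion S ⊆ poly.region := fun _ h => h.1

lemma isClosed_feasibleRegion : IsClosed (poly.feasibleRegion S) := by
  have : poly.feasibleRegion S
      = poly.region ∩ ⋂ x ∈ S, {g | segment ℝ x g ⊆ poly.region} := by
    ext g
    simp [mem_feasibleRegion_iff]
  rw [this]
  refine (isClosed_region poly).inter (isClosed_biInter fun x _ => ?_)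
  exact (isClosed_setOf_segment_subset (isClosed_region poly)).preimage
    (f := fun g => ((x, g) : Plane × Plane)) (by fun_prop)

/-- Feasible regions are convex relative to the region. -/
lemma segment_subset_feasibleRegion {a b : Plane} (ha : a ∈ poly.feasibleRegion S)
    (hb : b ∈ poly.feasibleRegion S) (hab : segment ℝ a b ⊆ poly.region) :
    segment ℝ a b ⊆ poly.feasibleRegion S := by
  intro z hz
  rw [mem_feasibleRegion_iff] at *
  exact ⟨hab hz, fun x hx => segment_subset_region_of_triangle (ha.2 x hx) (hb.2 x hx) hab hz⟩

end Feasible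

/-! ### Local structure of the region -/

lemma exists_pos_forall_le {ι : Type*} [Finite ι] (f : ι → ℝ) (hf : ∀ i, 0 < f i) :
    ∃ ρ > 0, ∀ i, ρ ≤ f i := by
  rcases isEmpty_or_nonempty ι with h | h
  · exact ⟨1, one_pos, fun i => h.elim i⟩
  · obtain ⟨i, hi⟩ := Finite.exists_min f
    exact ⟨f i, hf i, hi⟩

lemma exists_radius_notMem {A : Set Plane} (hA : IsClosed A) {z : Plane} (hz : z ∉ A) :
    ∃ ρ > 0, ∀ m : Plane, ‖m‖ < ρ → z + m ∉ A := by
  obtain ⟨ρ, hρ, h⟩ := Metric.isOpen_iff.1 hA.isOpen_compl z hz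
  refine ⟨ρ, hρ, fun m hm => h ?_⟩
  simpa [mem_ball_iff_norm] using hm

lemma norm_smul_lt_of_le_one {m : Plane} {t ρ : ℝ} (ht0 : 0 < t) (ht1 : t ≤ 1) (hm : ‖m‖ < ρ) :
    ‖t • m‖ < ρ := by
  rw [norm_smul, Real.norm_of_nonneg ht0.le]
  nlinarith [norm_nonneg m]

/-- `A` is invariant, within distance `ρ` of `z`, under scaling about `z`. -/
def IsConicAt (A : Set Plane) (z : Plane) (ρ : ℝ) : Prop :=
  ∀ m : Plane, ‖m‖ < ρ → ∀ t : ℝ, 0 < t → t ≤ 1 → (z + t • m ∈ A ↔ z + m ∈ A)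

lemma exists_isConicAt_segment (a b z : Plane) : ∃ ρ > 0, IsConicAt (segment ℝ a b) z ρ := by
  by_cases hz : z ∈ segment ℝ a b
  swap
  · have hcl : IsClosed (segment ℝ a b) := by
      rw [segment_eq_image']
      exact (isCompact_Icc.image (by fun_prop)).isClosed
    obtain ⟨ρ, hρ, h⟩ := exists_radius_notMem hcl hz
    exact ⟨ρ, hρ, fun m hm t ht0 ht1 =>
      iff_of_false (h _ (norm_smul_lt_of_le_one ht0 ht1 hm)) (h m hm)⟩
  have hconv : ∀ (m : Plane) (t : ℝ), 0 < t → t ≤ 1 → z + m ∈ segment ℝ a b →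
      z + t • m ∈ segment ℝ a b := fun m t ht0 ht1 hm => (convex_segment a b).segment_subset hz hm
      (mem_segment_iff_exists_smul.2 ⟨t, ht0.le, ht1, by simp⟩)
  by_cases hw : b - a = 0
  · have : b = a := sub_eq_zero.1 hw
    subst this
    refine ⟨1, one_pos, fun m hm t ht0 ht1 => ⟨fun h => ?_, hconv m t ht0 ht1⟩⟩
    simp only [segment_same, Set.mem_singleton_iff] at hz h ⊢
    subst hz
    have : t • m = 0 := by simpa using h
    rcases smul_eq_zero.1 this with h | h
    · exact absurd h ht0.ne'
    · simp [h]
  obtain ⟨s, hs0, hs1, rfl⟩ := mem_segment_iff_exists_smul.1 hz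
  have hwn : 0 < ‖b - a‖ := norm_pos_iff.2 hw
  obtain ⟨δ, hδ, hδ0, hδ1⟩ : ∃ δ > 0, (0 < s → δ ≤ s) ∧ (s < 1 → δ ≤ 1 - s) := by
    rcases hs0.eq_or_lt with h | h
    · exact ⟨1, one_pos, fun h' => by linarith, fun _ => by linarith⟩
    · rcases hs1.eq_or_lt with h' | h'
      · exact ⟨1, one_pos, fun _ => by linarith, fun h' => by linarith⟩
      · exact ⟨min s (1 - s), lt_min h (by linarith), fun _ => min_le_left _ _,
          fun _ => min_le_right _ _⟩
  refine ⟨‖b - a‖ * δ, by positivity, fun m hm t ht0 ht1 => ⟨fun h => ?_, hconv m t ht0 ht1⟩⟩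
  obtain ⟨s', hs0', hs1', he⟩ := mem_segment_iff_exists_smul.1 h
  have hm' : m = ((s' - s) / t) • (b - a) := by
    have h1 : t • m = (s' - s) • (b - a) := by
      rw [add_assoc, add_right_inj] at he
      rw [sub_smul, ← he]; abel
    rw [div_eq_inv_mul, mul_smul, ← h1, smul_smul, inv_mul_cancel₀ ht0.ne', one_smul]
  set κ := (s' - s) / t with hκ
  have hκt : κ * t = s' - s := by rw [hκ]; field_simp
  have hκδ : |κ| < δ := by
    rw [hm', norm_smul, Real.norm_eq_abs] at hm
    nlinarith
  rw [abs_lt] at hκδ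
  refine mem_segment_iff_exists_smul.2 ⟨s + κ, ?_, ?_, by rw [hm']; module⟩
  · by_cases hκ0 : 0 ≤ κ
    · linarith
    · have : 0 < s := by nlinarith
      linarith [hδ0 this]
  · by_cases hκ0 : κ ≤ 0
    · linarith
    · have : s < 1 := by nlinarith
      linarith [hδ1 this]

/-- The boundary is a finite union of segments, and segments are conic at every point. -/
lemma exists_isConicAt_boundary {n : ℕ} (poly : Polygon Plane n) (z : Plane) :
    ∃ ρ > 0, IsConicAt (poly.boundary ℝ) z ρ := by
  choose f hf0 hf using fun i => exists_isConicAt_segment (poly i) (poly (finRotate n i)) z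
  obtain ⟨ρ, hρ, hle⟩ := exists_pos_forall_le f hf0
  refine ⟨ρ, hρ, fun m hm t ht0 ht1 => ?_⟩
  simp only [mem_boundary_iff, edgeSet_eq_segment]
  exact exists_congr fun i => hf i m (hm.trans_le (hle i)) t ht0 ht1

/-- Scaling about `z` moves a point off the boundary along a segment that avoids the boundary, hence
within its component. -/
lemma exists_isConicAt_region {n : ℕ} (poly : Polygon Plane n) (z : Plane) :
    ∃ ρ > 0, IsConicAt poly.region z ρ := by
  obtain ⟨ρ, hρ, h⟩ := exists_isConicAt_boundary poly z
  refine ⟨ρ, hρ, fun m hm t ht0 ht1 => ?_⟩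
  by_cases hmC : z + m ∈ poly.boundary ℝ
  · exact iff_of_true (boundary_subset_region poly ((h m hm t ht0 ht1).2 hmC))
      (boundary_subset_region poly hmC)
  · refine mem_region_iff_of_isPreconnected poly
      (convex_segment (z + t • m) (z + m)).isPreconnected ?_ (left_mem_segment ℝ _ _)
      (right_mem_segment ℝ _ _)
    intro y hy
    obtain ⟨s, hs0, hs1, rfl⟩ := mem_segment_iff_exists_smul.1 hy
    have e : z + t • m + s • (z + m - (z + t • m)) = z + (t + s * (1 - t)) • m := by module
    rw [e]
    intro hc
    refine hmC ((h m hm _ ?_ ?_).1 hc)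
    · nlinarith
    · nlinarith

/-- Within distance `ρ` of `z`, the set `A` consists of the line through `z` in direction `w`,
of the open side to the left of it if `L` holds, and of the open side to the right if `R` holds. -/
def IsLinearAt (A : Set Plane) (z : Plane) (ρ : ℝ) (w : Plane) (L R : Prop) : Prop :=
  ∀ u : Plane, ‖u‖ < ρ → (z + u ∈ A ↔ (0 < cross w u → L) ∧ (cross w u < 0 → R))

lemma exists_isLinearAt_of_mem_interior {A : Set Plane} {z : Plane} (hz : z ∈ interior A)
    (w : Plane) : ∃ ρ > 0, IsLinearAt A z ρ w True True := by
  obtain ⟨ρ, hρ, h⟩ := Metric.isOpen_iff.1 isOpen_interior z hz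
  refine ⟨ρ, hρ, fun u hu => ?_⟩
  simp only [implies_true, and_self, iff_true]
  exact interior_subset (h (by simpa [mem_ball_iff_norm] using hu))

lemma convex_ball_inter_halfPlane (z w : Plane) (ρ : ℝ) :
    Convex ℝ {y : Plane | ‖y - z‖ < ρ ∧ 0 < cross w (y - z)} := by
  rintro a ⟨ha1, ha⟩ b ⟨hb1, hb⟩ s t hs ht hst
  have h1 := convex_ball z ρ (mem_ball_iff_norm.2 ha1) (mem_ball_iff_norm.2 hb1) hs ht hst
  refine ⟨mem_ball_iff_norm.1 h1, ?_⟩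
  have e : s • a + t • b - z = s • (a - z) + t • (b - z) := by
    have : z = (s + t) • z := by rw [hst, one_smul]
    conv_lhs => rw [this]
    module
  rw [e, cross_add_right, cross_smul_right, cross_smul_right]
  rcases hs.eq_or_lt with rfl | hs
  · have : t = 1 := by linarith
    subst this; simpa using hb
  · have := mul_pos hs ha
    have := mul_nonneg ht hb.le
    linarith

section Simple

variable {n : ℕ} {poly : Polygon Plane n}

lemma vertex_mem_edgeSet_left (i : Fin n) : poly i ∈ poly.edgeSet ℝ i := by
  rw [edgeSet_eq_segment]; exact left_mem_segment ℝ _ _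

lemma vertex_mem_edgeSet_right (i : Fin n) : poly (finRotate n i) ∈ poly.edgeSet ℝ i := by
  rw [edgeSet_eq_segment]; exact right_mem_segment ℝ _ _

lemma finRotate_ne (hpoly : poly.IsSimple) (i : Fin n) : finRotate n i ≠ i := by
  have h3 := hpoly.three_le
  obtain ⟨k, rfl⟩ : ∃ k, n = k + 1 + 1 := ⟨n - 2, by omega⟩
  rw [finRotate_apply]
  intro h
  simp at h

lemma edge_direction_ne_zero (hpoly : poly.IsSimple) (i : Fin n) :
    poly (finRotate n i) - poly i ≠ 0 := fun h =>
  finRotate_ne hpoly i (hpoly.injective (sub_eq_zero.1 h))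

/-- Near a point of an edge that is not a vertex of the polygon, the region consists of the line
carrying the edge and of some of its two sides. (By the Jordan curve theorem it is exactly one side,
but this is not needed.) -/
lemma exists_isLinearAt_of_mem_edgeSet (hpoly : poly.IsSimple) {z : Plane} {i : Fin n}
    (hz : z ∈ poly.edgeSet ℝ i) (hv : ∀ j, z ≠ poly j) :
    ∃ ρ > 0, ∃ L R, IsLinearAt poly.region z ρ (poly (finRotate n i) - poly i) L R := by
  have hw := edge_direction_ne_zero hpoly i
  set w := poly (finRotate n i) - poly i with hwdef
  obtain ⟨ρ₁, hρ₁, hcone⟩ := exists_isConicAt_boundary poly z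
  have hex : ∀ j : Fin n, ∃ ρ > 0, j ≠ i → ∀ m : Plane, ‖m‖ < ρ → z + m ∉ poly.edgeSet ℝ j := by
    intro j
    by_cases hj : j = i
    · exact ⟨1, one_pos, fun h => absurd hj h⟩
    · have hzj : z ∉ poly.edgeSet ℝ j := by
        intro h
        rcases hpoly.edge_inter i j (Ne.symm hj) z hz h with h | h
        · exact hv _ h.2
        · exact hv _ h.2
      obtain ⟨ρ, hρ, h⟩ := exists_radius_notMem (isCompact_edgeSet poly j).isClosed hzj
      exact ⟨ρ, hρ, fun _ => h⟩
  choose f hf0 hf using hex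
  obtain ⟨ρ₂, hρ₂, hle⟩ := exists_pos_forall_le f hf0
  set ρ := min ρ₁ ρ₂ with hρdef
  have hρ : 0 < ρ := lt_min hρ₁ hρ₂
  have hC : ∀ m : Plane, ‖m‖ < ρ → (z + m ∈ poly.boundary ℝ ↔ cross w m = 0) := by
    intro m hm
    have hm1 := hm.trans_le (min_le_left _ _)
    have hm2 := hm.trans_le (min_le_right _ _)
    have hz' := hz
    rw [edgeSet_eq_segment, mem_segment_iff_exists_smul] at hz'
    obtain ⟨s, hs0, hs1, hs⟩ := hz'
    rw [← hwdef] at hs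
    constructor
    · intro h
      obtain ⟨j, hj⟩ := (mem_boundary_iff poly).1 h
      have hji : j = i := by
        by_contra hji
        exact hf j hji m (hm2.trans_le (hle j)) hj
      subst hji
      rw [edgeSet_eq_segment, mem_segment_iff_exists_smul] at hj
      obtain ⟨s', -, -, hs'⟩ := hj
      have : m = (s' - s) • w := by
        rw [← hwdef, hs] at hs'
        have : m = poly j + s' • w - (poly j + s • w) := by rw [← hs']; abel
        rw [this]; module
      rw [this, cross_smul_right, cross_self, mul_zero]
    · intro h
      obtain ⟨κ, rfl⟩ := exists_smul_of_cross_eq_zero hw h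
      have hs0' : 0 < s := by
        refine lt_of_le_of_ne hs0 fun h => hv i ?_
        rw [hs, ← h]; simp
      have hs1' : s < 1 := by
        refine lt_of_le_of_ne hs1 fun h => hv (finRotate n i) ?_
        rw [hs, h, hwdef]; simp
      obtain ⟨t, ht0, ht1, ha, hb⟩ : ∃ t : ℝ, 0 < t ∧ t ≤ 1 ∧ 0 ≤ s + t * κ ∧ s + t * κ ≤ 1 := by
        have h0 : ∀ᶠ t : ℝ in 𝓝[>] 0, 0 < s + t * κ := by
          refine (Continuous.tendsto' (by fun_prop) 0 s (by simp)).mono_left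
            nhdsWithin_le_nhds |>.eventually (lt_mem_nhds hs0')
        have h1 : ∀ᶠ t : ℝ in 𝓝[>] 0, s + t * κ < 1 := by
          refine (Continuous.tendsto' (by fun_prop) 0 s (by simp)).mono_left
            nhdsWithin_le_nhds |>.eventually (gt_mem_nhds hs1')
        have h2 : ∀ᶠ t : ℝ in 𝓝[>] 0, t ∈ Set.Ioc 0 1 := Ioc_mem_nhdsGT one_pos
        obtain ⟨t, h0, h1, h2⟩ := (h0.and (h1.and h2)).exists
        exact ⟨t, h2.1, h2.2, h0.le, h1.le⟩
      rw [← hcone _ hm1 t ht0 ht1, mem_boundary_iff]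
      refine ⟨i, ?_⟩
      rw [edgeSet_eq_segment, mem_segment_iff_exists_smul]
      refine ⟨s + t * κ, ha, hb, ?_⟩
      rw [← hwdef, hs]; module
  have hside : ∀ w' : Plane, (∀ m, cross w m = 0 → cross w' m = 0) → ∀ m m' : Plane, ‖m‖ < ρ →
      ‖m'‖ < ρ → 0 < cross w' m → 0 < cross w' m' → z + m ∈ poly.region → z + m' ∈ poly.region := by
    intro w' hw' m m' hm hm' hc hc' hmem
    refine (mem_region_iff_of_isPreconnected poly
      (convex_ball_inter_halfPlane z w' ρ).isPreconnected ?_ ?_ ?_).1 hmem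
    · rintro y ⟨hy1, hy2⟩ hyC
      have e : y = z + (y - z) := by abel
      rw [e, hC _ hy1] at hyC
      exact hy2.ne' (hw' _ hyC)
    · simpa using ⟨hm, hc⟩
    · simpa using ⟨hm', hc'⟩
  refine ⟨ρ, hρ, ∀ m : Plane, ‖m‖ < ρ → 0 < cross w m → z + m ∈ poly.region,
    ∀ m : Plane, ‖m‖ < ρ → cross w m < 0 → z + m ∈ poly.region, fun u hu => ?_⟩
  constructor
  · intro h
    refine ⟨fun hc m hm hcm => hside w (fun _ => id) u m hu hm hc hcm h,
      fun hc m hm hcm => hside (-w) ?_ u m hu hm ?_ ?_ h⟩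
    · intro m hm; rw [cross_neg_left, hm, neg_zero]
    · rw [cross_neg_left]; linarith
    · rw [cross_neg_left]; linarith
  · rintro ⟨h1, h2⟩
    rcases lt_trichotomy 0 (cross w u) with h | h | h
    · exact h1 h u hu h
    · exact boundary_subset_region poly ((hC u hu).2 h.symm)
    · exact h2 h u hu h

lemma exists_isLinearAt (hpoly : poly.IsSimple) {z : Plane} (hz : z ∈ poly.region)
    (hv : ∀ j, z ≠ poly j) :
    ∃ ρ > 0, ∃ w, ∃ L R, w ≠ 0 ∧ IsLinearAt poly.region z ρ w L R := by
  have i : Fin n := ⟨0, by have := hpoly.three_le; omega⟩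
  by_cases hzi : z ∈ interior poly.region
  · obtain ⟨ρ, hρ, h⟩ := exists_isLinearAt_of_mem_interior hzi (poly (finRotate n i) - poly i)
    exact ⟨ρ, hρ, _, _, _, edge_direction_ne_zero hpoly i, h⟩
  · have hf : z ∈ frontier poly.region := by
      rw [(isClosed_region poly).frontier_eq]; exact ⟨hz, hzi⟩
    obtain ⟨j, hj⟩ := (mem_boundary_iff poly).1 (frontier_region_subset poly hf)
    obtain ⟨ρ, hρ, L, R, h⟩ := exists_isLinearAt_of_mem_edgeSet hpoly hj hv
    exact ⟨ρ, hρ, _, L, R, edge_direction_ne_zero hpoly j, h⟩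

/-- Near a vertex of the polygon, the boundary is contained in two rays. -/
lemma exists_boundary_subset_two_rays (hpoly : poly.IsSimple) (i : Fin n) :
    ∃ ρ > 0, ∃ c₁ c₂ : Plane, ∀ m : Plane, ‖m‖ < ρ → poly i + m ∈ poly.boundary ℝ →
      (∃ t : ℝ, 0 ≤ t ∧ m = t • c₁) ∨ ∃ t : ℝ, 0 ≤ t ∧ m = t • c₂ := by
  have hex : ∀ j : Fin n, ∃ ρ > 0, j ≠ i → finRotate n j ≠ i →
      ∀ m : Plane, ‖m‖ < ρ → poly i + m ∉ poly.edgeSet ℝ j := by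
    intro j
    by_cases hj : j = i
    · exact ⟨1, one_pos, fun h => absurd hj h⟩
    by_cases hj' : finRotate n j = i
    · exact ⟨1, one_pos, fun _ h => absurd hj' h⟩
    · have hzj : poly i ∉ poly.edgeSet ℝ j := by
        intro h
        rcases hpoly.edge_inter i j (Ne.symm hj) _ (vertex_mem_edgeSet_left i) h with h | h
        · exact hj (hpoly.injective h.2).symm
        · exact hj' h.1.symm
      obtain ⟨ρ, hρ, h⟩ := exists_radius_notMem (isCompact_edgeSet poly j).isClosed hzj
      exact ⟨ρ, hρ, fun _ _ => h⟩
  choose f hf0 hf using hex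
  obtain ⟨ρ, hρ, hle⟩ := exists_pos_forall_le f hf0
  refine ⟨ρ, hρ, poly (finRotate n i) - poly i, poly ((finRotate n).symm i) - poly i,
    fun m hm hmC => ?_⟩
  obtain ⟨j, hj⟩ := (mem_boundary_iff poly).1 hmC
  by_cases hji : j = i
  · subst hji
    left
    rw [edgeSet_eq_segment, mem_segment_iff_exists_smul] at hj
    obtain ⟨t, ht0, -, ht⟩ := hj
    exact ⟨t, ht0, add_left_cancel ht⟩
  by_cases hji' : finRotate n j = i
  · subst hji'
    right
    rw [edgeSet_eq_segment, segment_symm, mem_segment_iff_exists_smul] at hj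
    obtain ⟨t, ht0, -, ht⟩ := hj
    exact ⟨t, ht0, by rw [Equiv.symm_apply_apply]; exact add_left_cancel ht⟩
  · exact absurd hj (hf j hji hji' m (hm.trans_le (hle j)))

end Simple

/-! ### Blocking vertices -/

section Model

variable {w u u' : Plane} {L R : Prop}

/-- The vectors in the local model of `IsLinearAt` form a convex cone; this is closedness under
addition. -/
lemma linearModel_add (h : (0 < cross w u → L) ∧ (cross w u < 0 → R))
    (h' : (0 < cross w u' → L) ∧ (cross w u' < 0 → R)) :
    (0 < cross w (u + u') → L) ∧ (cross w (u + u') < 0 → R) := by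
  rw [cross_add_right]
  constructor
  · intro hc
    by_cases h0 : 0 < cross w u
    · exact h.1 h0
    · exact h'.1 (by linarith)
  · intro hc
    by_cases h0 : cross w u < 0
    · exact h.2 h0
    · exact h'.2 (by linarith)

lemma linearModel_smul (h : (0 < cross w u → L) ∧ (cross w u < 0 → R)) {t : ℝ} (ht : 0 ≤ t) :
    (0 < cross w (t • u) → L) ∧ (cross w (t • u) < 0 → R) := by
  rw [cross_smul_right]
  exact ⟨fun hc => h.1 (pos_of_mul_pos_right hc ht),
    fun hc => h.2 (by by_contra! h0; nlinarith [mul_nonneg ht h0])⟩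

end Model

lemma exists_small_pos_smul (u : Plane) {ρ : ℝ} (hρ : 0 < ρ) :
    ∃ t : ℝ, 0 < t ∧ t ≤ 1 ∧ ‖t • u‖ < ρ := by
  have h0 : ∀ᶠ t : ℝ in 𝓝[>] 0, ‖t • u‖ < ρ := by
    refine (Continuous.tendsto' (by fun_prop) 0 0 (by simp)).mono_left
      nhdsWithin_le_nhds |>.eventually (gt_mem_nhds hρ)
  have h2 : ∀ᶠ t : ℝ in 𝓝[>] 0, t ∈ Set.Ioc 0 1 := Ioc_mem_nhdsGT one_pos
  obtain ⟨t, h0, h2⟩ := (h0.and h2).exists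
  exact ⟨t, h2.1, h2.2, h0⟩

namespace IsLinearAt

variable {A : Set Plane} {z w a b : Plane} {ρ : ℝ} {L R : Prop}

lemma mem_of_segment_subset (h : IsLinearAt A z ρ w L R) (hρ : 0 < ρ) (hz : segment ℝ a z ⊆ A) :
    (0 < cross w (a - z) → L) ∧ (cross w (a - z) < 0 → R) := by
  obtain ⟨t, ht0, ht1, ht⟩ := exists_small_pos_smul (a - z) hρ
  have hm : z + t • (a - z) ∈ A := by
    apply hz
    rw [segment_symm, mem_segment_iff_exists_smul]
    exact ⟨t, ht0.le, ht1, rfl⟩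
  have := linearModel_smul ((h _ ht).1 hm) (inv_nonneg.2 ht0.le)
  rwa [smul_smul, inv_mul_cancel₀ ht0.ne', one_smul] at this

lemma segment_subset (h : IsLinearAt A z ρ w L R) (ha : a ∈ A) (hb : b ∈ A) (ha' : ‖a - z‖ < ρ)
    (hb' : ‖b - z‖ < ρ) : segment ℝ a b ⊆ A := by
  intro y hy
  have hy' := (convex_ball z ρ).segment_subset (mem_ball_iff_norm.2 ha') (mem_ball_iff_norm.2 hb')
    hy
  obtain ⟨s, hs0, hs1, rfl⟩ := mem_segment_iff_exists_smul.1 hy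
  have e : a + s • (b - a) = z + ((1 - s) • (a - z) + s • (b - z)) := by module
  rw [mem_ball_iff_norm] at hy'
  rw [e] at hy' ⊢
  rw [h _ (by simpa using hy')]
  have h1 := (h (a - z) ha').1 (by simpa using ha)
  have h2 := (h (b - z) hb').1 (by simpa using hb)
  exact linearModel_add (linearModel_smul h1 (by linarith)) (linearModel_smul h2 hs0)

end IsLinearAt

/-- The sign of a side of a directed line: `1` for the left side and `-1` for the right side. -/
def side (σ : Bool) : ℝ := if σ then 1 else -1

lemma exists_side_mul_pos {c : ℝ} (hc : c ≠ 0) : ∃ σ, 0 < side σ * c := by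
  rcases lt_or_gt_of_ne hc with h | h
  · exact ⟨false, by simpa [side] using h⟩
  · exact ⟨true, by simpa [side] using h⟩

section Blocking

variable {n : ℕ} (poly : Polygon Plane n)

/-- The point `v` limits, on the side `σ`, the view from `x` towards `q`: it lies on the line of
sight, and there are points outside the region arbitrarily close to `v` on the side `σ` of that
line. -/
structure IsBlocking (v : Plane) (σ : Bool) (x q : Plane) : Prop where
  segment_subset : segment ℝ x q ⊆ poly.region
  mem_openSegment : v ∈ openSegment ℝ x q
  exists_notMem : ∀ ε > 0, ∃ m : Plane, ‖m‖ < ε ∧ 0 < side σ * cross (q - v) m ∧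
    v + m ∉ poly.region

variable {poly}

/-- The triangle with vertices `x`, `q`, `g` contains an initial piece of every ray that starts
in an inner point `v` of the side `[x, q]` and points to the side of `g`. -/
lemma exists_smul_mem_region_of_triangle {x q g : Plane} (hxq : segment ℝ x q ⊆ poly.region)
    (hxg : segment ℝ x g ⊆ poly.region) (hqg : segment ℝ q g ⊆ poly.region) {τ : ℝ} (hτ0 : 0 < τ)
    (hτ1 : τ < 1) (α : ℝ) {β : ℝ} (hβ : 0 ≤ β) :
    ∃ t : ℝ, 0 < t ∧ t ≤ 1 ∧
      x + τ • (q - x) + t • (α • (q - x) + β • (g - q)) ∈ poly.region := by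
  have h0 : ∀ᶠ t : ℝ in 𝓝[>] 0, 0 < τ + t * α - t * β := by
    refine (Continuous.tendsto' (by fun_prop) 0 τ (by simp)).mono_left
      nhdsWithin_le_nhds |>.eventually (lt_mem_nhds hτ0)
  have h1 : ∀ᶠ t : ℝ in 𝓝[>] 0, τ + t * α < 1 := by
    refine (Continuous.tendsto' (by fun_prop) 0 τ (by simp)).mono_left
      nhdsWithin_le_nhds |>.eventually (gt_mem_nhds hτ1)
  have h2 : ∀ᶠ t : ℝ in 𝓝[>] 0, t ∈ Set.Ioc 0 1 := Ioc_mem_nhdsGT one_pos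
  obtain ⟨t, h0, h1, ht0, ht1⟩ := (h0.and (h1.and h2)).exists
  have htβ : 0 ≤ t * β := mul_nonneg ht0.le hβ
  have hpos : 0 < τ + t * α := by linarith
  refine ⟨t, ht0, ht1, ?_⟩
  refine segment_subset_region_of_triangle hxq hxg hqg (r := q + (t * β / (τ + t * α)) • (g - q))
    (mem_segment_iff_exists_smul.2 ⟨_, by positivity, by rw [div_le_one hpos]; linarith, rfl⟩)
    (mem_segment_iff_exists_smul.2 ⟨τ + t * α, hpos.le, h1.le, ?_⟩)
  have e : (τ + t * α) • (q + (t * β / (τ + t * α)) • (g - q) - x)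
      = (τ + t * α) • (q - x) + ((τ + t * α) * (t * β / (τ + t * α))) • (g - q) := by module
  rw [e, mul_div_cancel₀ _ hpos.ne']
  module

/-- A point visible from `x` and from `q` cannot lie strictly on the blocked side of `[x, q]`. -/
lemma IsBlocking.side_mul_cross_nonpos {v x q g : Plane} {σ : Bool}
    (h : IsBlocking poly v σ x q) (hxg : segment ℝ x g ⊆ poly.region)
    (hqg : segment ℝ q g ⊆ poly.region) : side σ * cross (q - v) (g - v) ≤ 0 := by
  by_contra! hpos
  obtain ⟨ρ, hρ, hcone⟩ := exists_isConicAt_region poly v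
  obtain ⟨m, hm, hside, hmP⟩ := h.exists_notMem ρ hρ
  obtain ⟨τ, hτ0, hτ1, hv⟩ := mem_openSegment_iff_exists_smul.1 h.mem_openSegment
  have hc : cross (q - v) (g - v) ≠ 0 := by
    intro h0; rw [h0, mul_zero] at hpos; exact lt_irrefl _ hpos
  set a := cross m (g - v) / cross (q - v) (g - v) with ha
  set β := cross (q - v) m / cross (q - v) (g - v) with hβ
  have hβ0 : 0 ≤ β := by
    have : 0 ≤ (side σ * cross (q - v) m) / (side σ * cross (q - v) (g - v)) :=
      (div_pos hside hpos).le
    rwa [mul_div_mul_left _ _ (by rintro h0; rw [h0, zero_mul] at hpos; exact lt_irrefl _ hpos)]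
      at this
  have hm' : m = ((a + β) * (1 - τ)) • (q - x) + β • (g - q) := by
    have h1 := eq_smul_add_smul_of_cross_ne_zero hc m
    rw [← ha, ← hβ] at h1
    conv_lhs => rw [h1, hv]
    module
  obtain ⟨t, ht0, ht1, ht⟩ := exists_smul_mem_region_of_triangle h.segment_subset hxg hqg hτ0 hτ1
    ((a + β) * (1 - τ)) hβ0
  rw [← hv, ← hm'] at ht
  exact hmP ((hcone m hm t ht0 ht1).1 ht)

/-- If `x` sees `p` but not the nearby point `p + u`, then the last point `p + s • u` seen by `x`
is seen past a polygon vertex that blocks the view on the side of `p + u`. -/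
lemma exists_isBlocking (hpoly : poly.IsSimple) {p u x w : Plane} {ρ : ℝ} {L R : Prop}
    (hlin : IsLinearAt poly.region p ρ w L R) (hu : ‖u‖ < ρ) (hpu : p + u ∈ poly.region)
    (hxp : segment ℝ x p ⊆ poly.region) (hxu : ¬ segment ℝ x (p + u) ⊆ poly.region) :
    ∃ i σ, ∃ s : ℝ, 0 ≤ s ∧ s < 1 ∧ IsBlocking poly (poly i) σ x (p + s • u) ∧
      0 < side σ * cross (p - poly i) u := by
  have hρ : 0 < ρ := (norm_nonneg u).trans_lt hu
  have hxP : x ∈ poly.region := hxp (left_mem_segment ℝ _ _)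
  have hpP : p ∈ poly.region := hxp (right_mem_segment ℝ _ _)
  have hcl := isClosed_region poly
  -- `p + s₀ • u` is the last point of `[p, p + u]` that is visible from `x`
  obtain ⟨s₀, ⟨⟨hs00, hs01⟩, hs₀⟩, hmax⟩ : ∃ s₀, IsGreatest
      (Set.Icc (0 : ℝ) 1 ∩ {s : ℝ | segment ℝ x (p + s • u) ⊆ poly.region}) s₀ := by
    refine (isCompact_Icc.inter_right ?_).exists_isGreatest ⟨0, by simp, by simpa using hxp⟩
    exact (isClosed_setOf_segment_subset hcl).preimage
      (f := fun s : ℝ => ((x, p + s • u) : Plane × Plane)) (by fun_prop)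
  have hs₀ : segment ℝ x (p + s₀ • u) ⊆ poly.region := hs₀
  have hs01 : s₀ < 1 := by
    refine lt_of_le_of_ne hs01 fun h => hxu ?_
    rwa [h, one_smul] at hs₀
  have hnot : ∀ s, s₀ < s → s ≤ 1 → ¬ segment ℝ x (p + s • u) ⊆ poly.region := fun s hs hs1 h =>
    absurd (hmax ⟨⟨hs00.trans hs.le, hs1⟩, h⟩) (not_le.2 hs)
  have hTu := (hlin u hu).1 hpu
  have hTx := hlin.mem_of_segment_subset hρ hxp
  have hnorm : ∀ s : ℝ, 0 ≤ s → s ≤ 1 → ‖s • u‖ < ρ := fun s h0 h1 => by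
    rw [norm_smul, Real.norm_of_nonneg h0]; nlinarith [norm_nonneg u]
  have hline : ∀ s : ℝ, 0 ≤ s → s ≤ 1 → p + s • u ∈ poly.region := fun s h0 h1 =>
    (hlin _ (hnorm s h0 h1)).2 (linearModel_smul hTu h0)
  set U := p + s₀ • u - x with hU
  have hD : cross U u ≠ 0 := by
    intro h0
    apply hxu
    have hcol : Collinear ℝ {p + s₀ • u, x, p + u} := by
      apply collinear_of_cross_eq_zero
      have e1 : x - (p + s₀ • u) = -U := by rw [hU]; abel
      have e2 : p + u - (p + s₀ • u) = (1 - s₀) • u := by module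
      rw [e1, e2, cross_neg_left, cross_smul_right, h0, mul_zero, neg_zero]
    refine (segment_subset_union_of_collinear hcol).trans (Set.union_subset ?_ ?_)
    · rwa [segment_symm]
    · exact hlin.segment_subset (hline s₀ hs00 hs01.le) hpu
        (by simpa using hnorm s₀ hs00 hs01.le) (by simpa using hu)
  -- parameters of the points of `[x, p + s₀ • u]` at which the segments `[x, p + s • u]` with
  -- `s` slightly larger than `s₀` leave the region
  set Z : Set ℝ := {τ | (0 ≤ τ ∧ τ ≤ 1) ∧ ∀ ε > 0, ∃ τ' h : ℝ, |τ' - τ| < ε ∧ 0 < h ∧ h < ε * τ' ∧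
    τ' ≤ 1 ∧ x + τ' • U + h • u ∉ poly.region} with hZ
  have hZne : Z.Nonempty := by
    have hex : ∀ ε > 0, ∃ τ' h : ℝ, 0 ≤ τ' ∧ 0 < h ∧ h < ε * τ' ∧
        τ' ≤ 1 ∧ x + τ' • U + h • u ∉ poly.region := by
      intro ε hε
      have hs : s₀ < min (s₀ + ε / 2) 1 := lt_min (by linarith) hs01
      set s := min (s₀ + ε / 2) 1 with hsdef
      have hsε : s ≤ s₀ + ε / 2 := min_le_left _ _
      obtain ⟨y, hy, hyP⟩ := Set.not_subset.1 (hnot s hs (min_le_right _ _))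
      obtain ⟨τ', h0, h1, rfl⟩ := mem_segment_iff_exists_smul.1 hy
      have hpos : 0 < τ' := by
        refine lt_of_le_of_ne h0 fun h => hyP ?_
        rw [← h]; simpa using hxP
      refine ⟨τ', τ' * (s - s₀), h0, mul_pos hpos (by linarith), by nlinarith, h1, ?_⟩
      have e : x + τ' • U + (τ' * (s - s₀)) • u = x + τ' • (p + s • u - x) := by
        rw [hU]; module
      rwa [e]
    choose τ h hτ0 hh0 hhτ hτ1 hP using fun k : ℕ => hex (1 / (k + 1)) (by positivity)
    obtain ⟨τ₀, hτ₀, φ, hφ, hlim⟩ := isCompact_Icc.tendsto_subseq (fun k => ⟨hτ0 k, hτ1 k⟩)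
    refine ⟨τ₀, hτ₀, fun ε hε => ?_⟩
    have h1 := Metric.tendsto_atTop.1 hlim ε hε
    obtain ⟨N, hN⟩ := h1
    obtain ⟨N', hN'⟩ := exists_nat_one_div_lt hε
    set k := max N N'
    refine ⟨τ (φ k), h (φ k), hN k (le_max_left _ _), hh0 _, (hhτ _).trans_le ?_, hτ1 _, hP _⟩
    apply mul_le_mul_of_nonneg_right _ (hτ0 _)
    refine le_trans ?_ hN'.le
    apply one_div_le_one_div_of_le (by positivity)
    have : N' ≤ φ k := (le_max_right N N').trans (hφ.id_le k)
    have : (N' : ℝ) ≤ φ k := by exact_mod_cast this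
    linarith
  have hZc : IsCompact Z := by
    have hsub : Z ⊆ Set.Icc 0 1 := fun τ h => h.1
    refine isCompact_Icc.of_isClosed_subset ?_ hsub
    rw [← closure_subset_iff_isClosed]
    intro τ hτ
    refine ⟨isClosed_Icc.closure_subset_iff.2 hsub hτ, fun ε hε => ?_⟩
    obtain ⟨τ₁, hτ₁, hd⟩ := Metric.mem_closure_iff.1 hτ (ε / 2) (by linarith)
    obtain ⟨τ', h, h1, h2, h3, h4, h5⟩ := hτ₁.2 (ε / 2) (by linarith)
    refine ⟨τ', h, ?_, h2, by nlinarith, h4, h5⟩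
    rw [Real.dist_eq, abs_sub_comm] at hd
    have := abs_sub_le τ' τ₁ τ
    linarith
  obtain ⟨τ, ⟨⟨hτ0, hτ1⟩, hτ⟩, hτmax⟩ := hZc.exists_isGreatest hZne
  have hsmall : ∀ δ > 0, ∃ ε > 0, ∀ τ' h : ℝ, |τ' - τ| < ε → 0 < h → h < ε * τ' → τ' ≤ 1 →
      ‖(τ' - τ) • U + h • u‖ < δ := by
    intro δ hδ
    refine ⟨δ / (‖U‖ + ‖u‖ + 1), by positivity, fun τ' h h1 h2 h3 h4 => ?_⟩
    set ε := δ / (‖U‖ + ‖u‖ + 1) with hε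
    have hε0 : 0 < ε := by positivity
    have hεδ : ε * (‖U‖ + ‖u‖ + 1) = δ := by rw [hε]; field_simp
    have hhε : h ≤ ε := by nlinarith
    calc ‖(τ' - τ) • U + h • u‖ ≤ |τ' - τ| * ‖U‖ + h * ‖u‖ := by
          refine (norm_add_le _ _).trans ?_
          rw [norm_smul, norm_smul, Real.norm_eq_abs, Real.norm_of_nonneg h2.le]
      _ ≤ ε * ‖U‖ + ε * ‖u‖ := by gcongr
      _ < δ := by linarith
  have hzP : x + τ • U ∈ poly.region := hs₀ (mem_segment_iff_exists_smul.2 ⟨τ, hτ0, hτ1, rfl⟩)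
  -- near `p + s₀ • u` the region is convex, so the view is not lost there
  have hτ1' : τ < 1 := by
    refine lt_of_le_of_ne hτ1 fun h1 => ?_
    subst h1
    obtain ⟨ε, hε, hεs⟩ := hsmall (ρ - ‖s₀ • u‖) (by linarith [hnorm s₀ hs00 hs01.le])
    obtain ⟨τ', h, h1, h2, h3, h4, h5⟩ := hτ (min ε (1 - s₀)) (lt_min hε (by linarith))
    have hτ'0 : 0 < τ' := by
      by_contra! hc
      have : 0 < min ε (1 - s₀) := lt_min hε (by linarith)
      nlinarith
    have hn := hεs τ' h (h1.trans_le (min_le_left _ _)) h2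
      (h3.trans_le (mul_le_mul_of_nonneg_right (min_le_left _ _) hτ'0.le)) h4
    apply h5
    have e : x + τ' • U + h • u = p + (s₀ • u + ((τ' - 1) • U + h • u)) := by rw [hU]; module
    have e' : s₀ • u + ((τ' - 1) • U + h • u)
        = (1 - τ') • (x - p) + (τ' * s₀ + h) • u := by rw [hU]; module
    rw [e, hlin _ ((norm_add_le _ _).trans_lt (by linarith)), e']
    exact linearModel_add (linearModel_smul hTx (by linarith))
      (linearModel_smul hTu (by positivity))
  -- the region is conic at `x`: if the view is lost arbitrarily close to `x`, then also further on
  have hτ0' : 0 < τ := by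
    refine lt_of_le_of_ne hτ0 fun h0 => ?_
    subst h0
    obtain ⟨r, hr, hcone⟩ := exists_isConicAt_region poly x
    set η := min 1 (r / (2 * (‖U‖ + ‖u‖ + 1))) with hη
    have hη0 : 0 < η := lt_min one_pos (by positivity)
    have hηr : η * (‖U‖ + ‖u‖ + 1) < r := by
      have : η ≤ r / (2 * (‖U‖ + ‖u‖ + 1)) := min_le_right _ _
      rw [le_div_iff₀ (by positivity)] at this
      nlinarith
    refine absurd (hτmax (a := η) ⟨⟨hη0.le, min_le_left _ _⟩, fun ε hε => ?_⟩) (not_le.2 hη0)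
    obtain ⟨ε₁, hε₁, hεs⟩ := hsmall r hr
    set ε₂ := min (min ε₁ ε) (min η 1) with hε₂
    have hε₂0 : 0 < ε₂ := lt_min (lt_min hε₁ hε) (lt_min hη0 one_pos)
    have hεε₁ : ε₂ ≤ ε₁ := (min_le_left _ _).trans (min_le_left _ _)
    have hεε : ε₂ ≤ ε := (min_le_left _ _).trans (min_le_right _ _)
    have hεη : ε₂ ≤ η := (min_le_right _ _).trans (min_le_left _ _)
    have hε1 : ε₂ ≤ 1 := (min_le_right _ _).trans (min_le_right _ _)
    obtain ⟨τ', h, h1, h2, h3, h4, h5⟩ := hτ ε₂ hε₂0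
    have hτ'0 : 0 < τ' := by by_contra! hc; nlinarith
    have hτ'η : τ' ≤ η := by
      rw [sub_zero] at h1; exact (le_abs_self _).trans (h1.le.trans hεη)
    have hhτ : h / τ' < ε₂ := by rwa [div_lt_iff₀ hτ'0]
    refine ⟨η, η * (h / τ'), by simpa using hε, by positivity, by nlinarith, min_le_left _ _, ?_⟩
    have hM : ‖U + (h / τ') • u‖ ≤ ‖U‖ + ‖u‖ := by
      refine (norm_add_le _ _).trans ?_
      rw [norm_smul, Real.norm_of_nonneg (by positivity)]
      nlinarith [norm_nonneg u]
    have hn : ‖η • (U + (h / τ') • u)‖ < r := by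
      rw [norm_smul, Real.norm_of_nonneg hη0.le]
      nlinarith
    have e1 : x + η • U + (η * (h / τ')) • u = x + η • (U + (h / τ') • u) := by module
    have e2 : x + τ' • U + h • u = x + (τ' / η) • (η • (U + (h / τ') • u)) := by
      rw [smul_smul, div_mul_cancel₀ _ hη0.ne', smul_add, smul_smul, mul_div_cancel₀ _ hτ'0.ne',
        add_assoc]
    rw [e1, ← hcone _ hn (τ' / η) (by positivity) (by rw [div_le_one hη0]; exact hτ'η), ← e2]
    exact h5
  -- at an inner point of an edge, the view would also be lost further along the line of sight
  obtain ⟨i, hi⟩ : ∃ i, x + τ • U = poly i := by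
    by_contra! hv
    obtain ⟨r, hr, w', L', R', -, hlin'⟩ := exists_isLinearAt hpoly hzP hv
    have hTU := hlin'.mem_of_segment_subset (a := x) hr
      (((convex_segment x _).segment_subset (left_mem_segment ℝ _ _)
        (mem_segment_iff_exists_smul.2 ⟨τ, hτ0, hτ1, rfl⟩)).trans hs₀)
    obtain ⟨η₁, hη₁, -, hη₁r⟩ := exists_small_pos_smul U (half_pos hr)
    set η := min η₁ ((1 - τ) / 2) with hη
    have hη0 : 0 < η := lt_min hη₁ (by linarith)
    have hητ : η ≤ (1 - τ) / 2 := min_le_right _ _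
    have hηr : ‖η • U‖ < r / 2 := by
      refine lt_of_le_of_lt ?_ hη₁r
      rw [norm_smul, norm_smul, Real.norm_of_nonneg hη0.le, Real.norm_of_nonneg hη₁.le]
      exact mul_le_mul_of_nonneg_right (min_le_left _ _) (norm_nonneg _)
    refine absurd (hτmax (a := τ + η) ⟨⟨by linarith, by linarith⟩, fun ε hε => ?_⟩) (by linarith)
    obtain ⟨ε₁, hε₁, hεs⟩ := hsmall (r / 2) (half_pos hr)
    set ε₂ := min (min ε₁ ε) ((1 - τ) / 2) with hε₂
    have hε₂0 : 0 < ε₂ := lt_min (lt_min hε₁ hε) (by linarith)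
    have hεε₁ : ε₂ ≤ ε₁ := (min_le_left _ _).trans (min_le_left _ _)
    have hεε : ε₂ ≤ ε := (min_le_left _ _).trans (min_le_right _ _)
    have hετ : ε₂ ≤ (1 - τ) / 2 := min_le_right _ _
    obtain ⟨τ', h, h1, h2, h3, h4, h5⟩ := hτ ε₂ hε₂0
    have hτ'0 : 0 < τ' := by by_contra! hc; nlinarith
    have hτ'1 : τ' < τ + (1 - τ) / 2 := by
      have := (abs_lt.1 h1).2
      linarith
    have hn := hεs τ' h (h1.trans_le hεε₁) h2
      (h3.trans_le (mul_le_mul_of_nonneg_right hεε₁ hτ'0.le)) h4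
    refine ⟨τ' + η, h, by rw [add_sub_add_right_eq_sub]; exact h1.trans_le hεε, h2,
      by nlinarith, by linarith, ?_⟩
    have e1 : x + (τ' + η) • U + h • u = x + τ • U + (((τ' - τ) • U + h • u) + η • U) := by module
    have e2 : x + τ' • U + h • u = x + τ • U + ((τ' - τ) • U + h • u) := by module
    rw [e2, hlin' _ (by linarith)] at h5
    rw [e1, hlin' _ ((norm_add_le _ _).trans_lt (by linarith))]
    intro hc
    apply h5
    have e3 : (τ' - τ) • U + h • u
        = ((τ' - τ) • U + h • u + η • U) + (η / τ) • (x - (x + τ • U)) := by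
      have : (η / τ) • (x - (x + τ • U)) = -((η / τ * τ) • U) := by module
      rw [this, div_mul_cancel₀ _ hτ0'.ne']
      abel
    rw [e3]
    exact linearModel_add hc (linearModel_smul hTU (by positivity))
  obtain ⟨σ, hσ⟩ := exists_side_mul_pos hD
  have hqv : p + s₀ • u - poly i = (1 - τ) • U := by rw [← hi, hU]; module
  refine ⟨i, σ, s₀, hs00, hs01, ⟨hs₀, ?_, fun ε hε => ?_⟩, ?_⟩
  · exact mem_openSegment_iff_exists_smul.2 ⟨τ, hτ0', hτ1', hi.symm⟩
  · obtain ⟨ε₁, hε₁, hεs⟩ := hsmall ε hε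
    obtain ⟨τ', h, h1, h2, h3, h4, h5⟩ := hτ ε₁ hε₁
    refine ⟨(τ' - τ) • U + h • u, hεs τ' h h1 h2 h3 h4, ?_, ?_⟩
    · rw [hqv, cross_smul_left, cross_add_right, cross_smul_right, cross_smul_right, cross_self]
      have := mul_pos (mul_pos (sub_pos.2 hτ1') h2) hσ
      linarith
    · rw [← hi]
      have e2 : x + τ' • U + h • u = x + τ • U + ((τ' - τ) • U + h • u) := by module
      rwa [← e2]
  · have e : p - poly i = (1 - τ) • U - s₀ • u := by rw [← hqv]; abel
    rw [e, cross_sub_left, cross_smul_left, cross_smul_left, cross_self]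
    have := mul_pos (sub_pos.2 hτ1') hσ
    linarith

end Blocking

/-! ### Supporting lines of the feasible region -/

section Support

variable {n : ℕ} (poly : Polygon Plane n)

/-- The point `v` supports the feasible region of `S` at `p` on the side `σ` if points arbitrarily
close to `p` are seen from points of `S` past `v`, with `v` limiting the view on the side `σ`.
The approximating points `q` and lines of sight are needed because the points of `S` may
converge to `v`. -/
def IsSupport (S : Set Plane) (v : Plane) (σ : Bool) (p : Plane) : Prop :=
  ∀ ε > 0, ∃ x ∈ S, ∃ q : Plane, ‖q - p‖ < ε ∧ IsBlocking poly v σ x q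

variable {poly} {S : Set Plane} {v p g : Plane} {σ : Bool}

lemma IsSupport.exists_of_eventually (h : IsSupport poly S v σ p) {Q : Plane → Prop}
    (hQ : ∀ᶠ q in 𝓝 p, Q q) : ∃ x ∈ S, ∃ q, Q q ∧ IsBlocking poly v σ x q := by
  obtain ⟨ε, hε, hball⟩ := Metric.eventually_nhds_iff.1 hQ
  obtain ⟨x, hx, q, hq, hb⟩ := h ε hε
  exact ⟨x, hx, q, hball (by rwa [dist_eq_norm]), hb⟩

lemma IsSupport.segment_subset (h : IsSupport poly S v σ p) : segment ℝ v p ⊆ poly.region := by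
  by_contra hc
  have hcl : IsClosed {q : Plane | segment ℝ v q ⊆ poly.region} :=
    (isClosed_setOf_segment_subset (isClosed_region poly)).preimage
      (f := fun g => ((v, g) : Plane × Plane)) (by fun_prop)
  obtain ⟨x, -, q, hq, hb⟩ := h.exists_of_eventually (hcl.isOpen_compl.mem_nhds hc)
  exact hq (((convex_segment x q).segment_subset (openSegment_subset_segment ℝ x q hb.2)
    (right_mem_segment ℝ x q)).trans hb.1)

/-- Near `p`, the feasible region lies on one side of every supporting line. -/
lemma IsSupport.side_mul_cross_nonpos (h : IsSupport poly S v σ p) {w : Plane} {ρ : ℝ} {L R : Prop}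
    (hlin : IsLinearAt poly.region p ρ w L R) (hg : g ∈ poly.feasibleRegion S)
    (hgρ : ‖g - p‖ < ρ) : side σ * cross (p - v) (g - p) ≤ 0 := by
  by_contra! hc
  have hρ : 0 < ρ := (norm_nonneg _).trans_lt hgρ
  have e : cross (p - v) (g - p) = cross (p - v) (g - v) := by
    have : g - p = g - v - (p - v) := by abel
    rw [this, cross_sub_right, cross_self, sub_zero]
  rw [e] at hc
  have h1 : ∀ᶠ q in 𝓝 p, 0 < side σ * cross (q - v) (g - v) :=
    (Continuous.tendsto (by fun_prop) p : Filter.Tendsto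
      (fun q => side σ * cross (q - v) (g - v)) (𝓝 p) _).eventually (lt_mem_nhds hc)
  have h2 : ∀ᶠ q in 𝓝 p, ‖q - p‖ < ρ := by
    filter_upwards [Metric.ball_mem_nhds p hρ] with q hq using mem_ball_iff_norm.1 hq
  obtain ⟨x, hx, q, ⟨hq1, hq2⟩, hb⟩ := h.exists_of_eventually (h1.and h2)
  refine absurd (hb.side_mul_cross_nonpos ((mem_feasibleRegion_iff.1 hg).2 x hx) ?_)
    (not_le.2 hq1)
  exact hlin.segment_subset (hb.1 (right_mem_segment ℝ _ _)) (feasibleRegion_subset_region hg)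
    hq2 hgρ

/-- If `p` lies between two points of the feasible region that it sees, then every line that
supports the feasible region at `p` contains these points. -/
lemma IsSupport.cross_eq_zero_of_mem_openSegment (h : IsSupport poly S v σ p) {w a b : Plane}
    {ρ : ℝ} {L R : Prop} (hρ : 0 < ρ) (hlin : IsLinearAt poly.region p ρ w L R)
    (hp : p ∈ poly.feasibleRegion S) (ha : a ∈ poly.feasibleRegion S)
    (hb : b ∈ poly.feasibleRegion S) (hpa : segment ℝ p a ⊆ poly.region)
    (hpb : segment ℝ p b ⊆ poly.region) (hab : p ∈ openSegment ℝ a b) :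
    cross (p - v) (a - p) = 0 := by
  have key : ∀ c ∈ poly.feasibleRegion S, segment ℝ p c ⊆ poly.region →
      side σ * cross (p - v) (c - p) ≤ 0 := by
    intro c hc hpc
    obtain ⟨t, ht0, ht1, ht⟩ := exists_small_pos_smul (c - p) hρ
    have hmem : p + t • (c - p) ∈ poly.feasibleRegion S := segment_subset_feasibleRegion hp hc hpc
      (mem_segment_iff_exists_smul.2 ⟨t, ht0.le, ht1, rfl⟩)
    have := h.side_mul_cross_nonpos hlin hmem (by simpa using ht)
    rw [add_sub_cancel_left, cross_smul_right] at this
    by_contra! hpos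
    nlinarith
  have h1 := key a ha hpa
  have h2 := key b hb hpb
  obtain ⟨t, ht0, ht1, hp'⟩ := mem_openSegment_iff_exists_smul.1 hab
  have e : (1 - t) • (a - p) + t • (b - p) = 0 := by
    have : (1 - t) • (a - p) + t • (b - p) = a + t • (b - a) - p := by module
    rw [this, ← hp', sub_self]
  have e2 : (1 - t) * cross (p - v) (a - p) + t * cross (p - v) (b - p) = 0 := by
    rw [← cross_smul_right, ← cross_smul_right, ← cross_add_right, e, cross_zero_right]
  have h3 : 0 ≤ side σ * cross (p - v) (a - p) := by
    by_contra! hneg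
    have : (1 - t) * (side σ * cross (p - v) (a - p))
        + t * (side σ * cross (p - v) (b - p)) = 0 := by
      linear_combination side σ * e2
    nlinarith
  have h4 := le_antisymm h1 h3
  have : side σ ≠ 0 := by cases σ <;> simp [side]
  exact (mul_eq_zero.1 h4).resolve_left this

/-- Suppose that the frontier of a closed set near `v` is contained in two rays, that the line
through `v` in direction `h` runs inside the set near `v`, and that there is a point outside the set
on one side of this line. Then both rays point to this side. -/
lemma rays_on_side {A : Set Plane} (hA : IsClosed A) {h m c₁ c₂ : Plane} {ρ : ℝ}
    (hrays : ∀ m : Plane, ‖m‖ < ρ → v + m ∈ frontier A →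
      (∃ t : ℝ, 0 ≤ t ∧ m = t • c₁) ∨ ∃ t : ℝ, 0 ≤ t ∧ m = t • c₂)
    (hh : ‖h‖ < ρ) (hm : ‖m‖ < ρ) (h1 : v + h ∈ interior A) (h2 : v - h ∈ interior A)
    (hmA : v + m ∉ A) {e : ℝ} (hem : 0 < e * cross h m) :
    0 < e * cross h c₁ ∧ 0 < e * cross h c₂ := by
  have hcross : ∀ k : Plane, ‖k‖ < ρ → v + k ∈ interior A → ∃ θ : ℝ, 0 < θ ∧ θ < 1 ∧
      ((∃ t : ℝ, 0 ≤ t ∧ m + θ • (k - m) = t • c₁) ∨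
        ∃ t : ℝ, 0 ≤ t ∧ m + θ • (k - m) = t • c₂) := by
    intro k hk hkA
    obtain ⟨z, hz, hzf⟩ : ∃ z ∈ segment ℝ (v + m) (v + k), z ∈ frontier A := by
      by_contra! hno
      have hcov : segment ℝ (v + m) (v + k) ⊆ interior A ∪ Aᶜ := by
        intro y hy
        by_cases hyA : y ∈ A
        · left
          by_contra hyi
          exact hno y hy (by rw [hA.frontier_eq]; exact ⟨hyA, hyi⟩)
        · exact Or.inr hyA
      have hdis : Disjoint (interior A) Aᶜ :=
        Set.disjoint_left.2 fun y hy hy' => hy' (interior_subset hy)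
      have := (convex_segment (v + m) (v + k)).isPreconnected.subset_left_of_subset_union
        isOpen_interior hA.isOpen_compl hdis hcov ⟨_, right_mem_segment ℝ _ _, hkA⟩
      exact hmA (interior_subset (this (left_mem_segment ℝ _ _)))
    rw [hA.frontier_eq] at hzf
    obtain ⟨θ, hθ0, hθ1, rfl⟩ := mem_segment_iff_exists_smul.1 hz
    have ez : v + m + θ • (v + k - (v + m)) = v + (m + θ • (k - m)) := by module
    have hθ0' : 0 < θ := by
      refine lt_of_le_of_ne hθ0 fun h0 => hmA ?_
      have := hzf.1
      rw [← h0] at this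
      simpa using this
    have hθ1' : θ < 1 := by
      refine lt_of_le_of_ne hθ1 fun h0 => hzf.2 ?_
      rw [h0]
      simpa using hkA
    refine ⟨θ, hθ0', hθ1', hrays _ ?_ ?_⟩
    · have := (convex_ball (0 : Plane) ρ).segment_subset (x := m) (y := k) (by simpa using hm)
        (by simpa using hk) (mem_segment_iff_exists_smul.2 ⟨θ, hθ0, hθ1, rfl⟩)
      simpa using this
    · rw [← ez, hA.frontier_eq]; exact hzf
  obtain ⟨θ, h0, h1', hθ⟩ := hcross h hh h1
  obtain ⟨θ', h0', h1'', hθ'⟩ := hcross (-h) (by simpa using hh) (by rwa [← sub_eq_add_neg])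
  have e1 : cross h (m + θ • (h - m)) = (1 - θ) * cross h m := by
    rw [cross_add_right, cross_smul_right, cross_sub_right, cross_self]; ring
  have e2 : cross h (m + θ' • (-h - m)) = (1 - θ') * cross h m := by
    rw [cross_add_right, cross_smul_right, cross_sub_right, cross_neg_right, cross_self]; ring
  have e3 : cross (m + θ • (h - m)) (m + θ' • (-h - m))
      = ((1 - θ) * θ' + θ * (1 - θ')) * cross h m := by
    simp only [cross_add_right, cross_smul_right, cross_sub_right, cross_neg_right, cross_self,
      cross_add_left, cross_smul_left, cross_sub_left, cross_swap h m]
    ring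
  have hne : cross h m ≠ 0 := by
    intro h0; rw [h0, mul_zero] at hem; exact lt_irrefl _ hem
  -- the two crossings of the frontier are on different rays
  have hdiff : ∀ c : Plane, ∀ t t' : ℝ, m + θ • (h - m) = t • c → m + θ' • (-h - m) = t' • c →
      False := by
    intro c t t' ht ht'
    rw [ht, ht', cross_smul_left, cross_smul_right, cross_self, mul_zero, mul_zero] at e3
    have : 0 < (1 - θ) * θ' + θ * (1 - θ') :=
      add_pos (mul_pos (by linarith) h0') (mul_pos h0 (by linarith))
    exact (mul_ne_zero this.ne' hne) e3.symm
  have hpos : ∀ (c : Plane) (t s : ℝ), 0 ≤ t → s < 1 → t * cross h c = (1 - s) * cross h m →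
      0 < e * cross h c := by
    intro c t s ht hs heq
    have h1 : 0 < t * (e * cross h c) := by
      have := mul_pos (sub_pos.2 hs) hem
      calc 0 < (1 - s) * (e * cross h m) := this
        _ = t * (e * cross h c) := by linear_combination -e * heq
    exact pos_of_mul_pos_right h1 ht
  rcases hθ with ⟨t, ht, hc⟩ | ⟨t, ht, hc⟩ <;> rcases hθ' with ⟨t', ht', hc'⟩ | ⟨t', ht', hc'⟩
  · exact (hdiff _ _ _ hc hc').elim
  · rw [hc, cross_smul_right] at e1
    rw [hc', cross_smul_right] at e2
    exact ⟨hpos _ _ _ ht h1' e1, hpos _ _ _ ht' h1'' e2⟩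
  · rw [hc, cross_smul_right] at e1
    rw [hc', cross_smul_right] at e2
    exact ⟨hpos _ _ _ ht' h1'' e2, hpos _ _ _ ht h1' e1⟩
  · exact (hdiff _ _ _ hc hc').elim

/-- A triangle in the region with vertex `v` spans a cone that is contained in the region near
`v`. -/
lemma add_mem_region_of_triangle {a b m : Plane} {ρ : ℝ} (hcone : IsConicAt poly.region v ρ)
    (hva : segment ℝ v a ⊆ poly.region) (hvb : segment ℝ v b ⊆ poly.region)
    (hab : segment ℝ a b ⊆ poly.region) {α β : ℝ} (hα : 0 ≤ α) (hβ : 0 ≤ β)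
    (hm : m = α • (a - v) + β • (b - v)) (hmρ : ‖m‖ < ρ) : v + m ∈ poly.region := by
  by_cases h0 : α + β = 0
  · have hα0 : α = 0 := by linarith
    have hβ0 : β = 0 := by linarith
    rw [hm, hα0, hβ0]
    simpa using hva (left_mem_segment ℝ _ _)
  have hpos : 0 < α + β := lt_of_le_of_ne (by positivity) (Ne.symm h0)
  set t := 1 / (1 + α + β) with ht
  have ht0 : 0 < t := by positivity
  have htt : t * (1 + α + β) = 1 := by rw [ht]; field_simp
  have ht1 : t ≤ 1 := by nlinarith
  rw [← hcone m hmρ t ht0 ht1]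
  refine segment_subset_region_of_triangle hva hvb hab (r := a + (β / (α + β)) • (b - a))
    (mem_segment_iff_exists_smul.2 ⟨_, by positivity, by rw [div_le_one hpos]; linarith, rfl⟩)
    (mem_segment_iff_exists_smul.2 ⟨t * (α + β), by positivity, by nlinarith, ?_⟩)
  have e : (t * (α + β)) • (a + (β / (α + β)) • (b - a) - v)
      = (t * (α + β)) • (a - v) + (t * ((α + β) * (β / (α + β)))) • (b - a) := by module
  rw [e, mul_div_cancel₀ _ h0, hm]
  module

end Support

section Uniqueness

variable {n : ℕ} {poly : Polygon Plane n} {S : Set Plane} {p p' : Plane} {σ : Bool}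

/-- If one polygon vertex supported the feasible region on the same side along two different
lines, then the complement of the region would enter every neighbourhood of the vertex on both
sides of a line inside the region; but only two edges end there. -/
lemma IsSupport.side_mul_cross_nonpos_of_isSupport (hpoly : poly.IsSimple) {i : Fin n}
    (h : IsSupport poly S (poly i) σ p) (h' : IsSupport poly S (poly i) σ p')
    (hp : p ∈ poly.feasibleRegion S) (hp' : p' ∈ poly.feasibleRegion S)
    (hp'v : ∀ j, p' ≠ poly j) : side σ * cross (p - poly i) (p' - poly i) ≤ 0 := by
  by_contra! hpos
  set v := poly i with hv
  set s := side σ with hs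
  set P₁ := p - v with hP₁
  set P₂ := p' - v with hP₂
  have hgP₁ : cross (p' - p) P₁ = -cross P₁ P₂ := by
    have : p' - p = P₂ - P₁ := by rw [hP₁, hP₂]; abel
    rw [this, cross_sub_left, cross_self, cross_swap P₁ P₂]; ring
  have hgP₂ : cross (p' - p) P₂ = -cross P₁ P₂ := by
    have : p' - p = P₂ - P₁ := by rw [hP₁, hP₂]; abel
    rw [this, cross_sub_left, cross_self]; ring
  set g := p' - p with hg
  obtain ⟨r, hr, w, L, R, -, hlin⟩ :=
    exists_isLinearAt hpoly (feasibleRegion_subset_region hp') hp'v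
  obtain ⟨ρ₁, hρ₁, hcone₁⟩ := exists_isConicAt_region poly v
  obtain ⟨ρ₂, hρ₂, c₁, c₂, hrays₂⟩ := exists_boundary_subset_two_rays hpoly i
  set ρ := min ρ₁ ρ₂
  have hρ : 0 < ρ := lt_min hρ₁ hρ₂
  have hcone : IsConicAt poly.region v ρ := fun m hm => hcone₁ m (hm.trans_le (min_le_left _ _))
  have hrays : ∀ m : Plane, ‖m‖ < ρ → v + m ∈ frontier poly.region →
      (∃ t : ℝ, 0 ≤ t ∧ m = t • c₁) ∨ ∃ t : ℝ, 0 ≤ t ∧ m = t • c₂ := fun m hm hmf =>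
    hrays₂ m (hm.trans_le (min_le_right _ _)) (frontier_region_subset poly hmf)
  -- lines of sight `[x, q]` and `[x', q']` past `v` that are close to `[v, p]` and `[v, p']`
  obtain ⟨x, hx, q, ⟨hq1, hq2⟩, hb⟩ := h.exists_of_eventually
    (Q := fun q => 0 < s * cross (q - v) P₂ ∧ s * cross g (q - v) < 0) (by
      have h1 : Filter.Tendsto (fun q => s * cross (q - v) P₂) (𝓝 p) (𝓝 (s * cross P₁ P₂)) :=
        Continuous.tendsto (by fun_prop) p
      have h2 : Filter.Tendsto (fun q => s * cross g (q - v)) (𝓝 p) (𝓝 (s * cross g P₁)) :=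
        Continuous.tendsto (by fun_prop) p
      exact (h1.eventually (lt_mem_nhds hpos)).and
        (h2.eventually (gt_mem_nhds (by rw [hgP₁]; linarith))))
  set d := q - v with hd
  obtain ⟨x', hx', q', ⟨⟨hq'1, hq'2⟩, ⟨hq'3, hq'4⟩, hq'5⟩, hb'⟩ := h'.exists_of_eventually
    (Q := fun q' => (0 < s * cross P₁ (q' - v) ∧ s * cross g (q' - v) < 0) ∧
      (0 < s * cross d (q' - v) ∧ 0 < s * cross (q' - v) g) ∧ ‖q' - p'‖ < r) (by
      have h1 : Filter.Tendsto (fun q => s * cross P₁ (q - v)) (𝓝 p') (𝓝 (s * cross P₁ P₂)) :=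
        Continuous.tendsto (by fun_prop) p'
      have h2 : Filter.Tendsto (fun q => s * cross g (q - v)) (𝓝 p') (𝓝 (s * cross g P₂)) :=
        Continuous.tendsto (by fun_prop) p'
      have h3 : Filter.Tendsto (fun q => s * cross d (q - v)) (𝓝 p') (𝓝 (s * cross d P₂)) :=
        Continuous.tendsto (by fun_prop) p'
      have h4 : Filter.Tendsto (fun q => s * cross (q - v) g) (𝓝 p') (𝓝 (s * cross P₂ g)) :=
        Continuous.tendsto (by fun_prop) p'
      refine ((h1.eventually (lt_mem_nhds hpos)).and
        (h2.eventually (gt_mem_nhds (by rw [hgP₂]; linarith)))).and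
        (((h3.eventually (lt_mem_nhds hq1)).and
          (h4.eventually (lt_mem_nhds (by rw [cross_swap g P₂, hgP₂]; linarith)))).and ?_)
      filter_upwards [Metric.ball_mem_nhds p' hr] with q hq using mem_ball_iff_norm.1 hq)
  set d' := q' - v with hd'
  have hseg : ∀ {x q : Plane}, IsBlocking poly v σ x q →
      segment ℝ v x ⊆ poly.region ∧ ∃ c : ℝ, 0 < c ∧ x - v = -(c • (q - v)) := by
    intro x q hb
    have hvm := openSegment_subset_segment ℝ x q hb.2
    refine ⟨((convex_segment x q).segment_subset hvm (left_mem_segment ℝ x q)).trans hb.1, ?_⟩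
    obtain ⟨t, ht0, ht1, ht⟩ := mem_openSegment_iff_exists_smul.1 hb.2
    refine ⟨t / (1 - t), div_pos ht0 (by linarith), ?_⟩
    have e : q - v = (1 - t) • (q - x) := by rw [ht]; module
    rw [e, smul_smul, div_mul_cancel₀ _ (by linarith), ht]
    module
  obtain ⟨hvx, c, hc, hxc⟩ := hseg hb
  obtain ⟨hvx', c', hc', hxc'⟩ := hseg hb'
  have hsee := (mem_feasibleRegion_iff.1 hp').2 x hx
  have hsee' := (mem_feasibleRegion_iff.1 hp).2 x' hx'
  -- the triangles `v p' x` and `v p x'`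
  have hT : ∀ α β : ℝ, 0 ≤ α → 0 ≤ β → ‖α • P₂ - β • d‖ < ρ →
      v + (α • P₂ - β • d) ∈ poly.region := by
    intro α β hα hβ hn
    refine add_mem_region_of_triangle hcone h'.segment_subset hvx (by rwa [segment_symm]) hα
      (β := β / c) (by positivity) ?_ hn
    rw [hxc, smul_neg, smul_smul, div_mul_cancel₀ _ hc.ne', sub_eq_add_neg]
  have hT' : ∀ α β : ℝ, 0 ≤ α → 0 ≤ β → ‖α • P₁ - β • d'‖ < ρ →
      v + (α • P₁ - β • d') ∈ poly.region := by
    intro α β hα hβ hn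
    refine add_mem_region_of_triangle hcone h.segment_subset hvx' (by rwa [segment_symm]) hα
      (β := β / c') (by positivity) ?_ hn
    rw [hxc', smul_neg, smul_smul, div_mul_cancel₀ _ hc'.ne', sub_eq_add_neg]
  -- the cones spanned by these triangles
  have hcone_of : ∀ (e : ℝ) (a b m : Plane), 0 < e * cross b a →
      m = ((e * cross b m) / (e * cross b a)) • a - ((e * cross a m) / (e * cross b a)) • b := by
    intro e a b m hab
    have hne : cross b a ≠ 0 := by intro h0; rw [h0, mul_zero] at hab; exact lt_irrefl _ hab
    have hsne : e ≠ 0 := by intro h0; rw [h0, zero_mul] at hab; exact lt_irrefl _ hab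
    rw [mul_div_mul_left _ _ hsne, mul_div_mul_left _ _ hsne]
    conv_lhs => rw [eq_smul_add_smul_of_cross_ne_zero hne m]
    rw [cross_swap a m]
    module
  have hint : ∀ {e : ℝ} {a b k : Plane}, (∀ α β : ℝ, 0 ≤ α → 0 ≤ β → ‖α • a - β • b‖ < ρ →
      v + (α • a - β • b) ∈ poly.region) → 0 < e * cross b a → 0 < e * cross b k →
      0 < e * cross a k → ‖k‖ < ρ → v + k ∈ interior poly.region := by
    intro e a b k hab hba hbk hak hk
    rw [mem_interior_iff_mem_nhds]
    have h1 : ∀ᶠ y in 𝓝 (v + k), 0 < e * cross b (y - v) :=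
      (Continuous.tendsto' (f := fun y => e * cross b (y - v)) (by fun_prop) (v + k)
        (e * cross b k) (by simp)).eventually (lt_mem_nhds hbk)
    have h2 : ∀ᶠ y in 𝓝 (v + k), 0 < e * cross a (y - v) :=
      (Continuous.tendsto' (f := fun y => e * cross a (y - v)) (by fun_prop) (v + k)
        (e * cross a k) (by simp)).eventually (lt_mem_nhds hak)
    have h3 : ∀ᶠ y in 𝓝 (v + k), ‖y - v‖ < ρ :=
      (Continuous.tendsto' (f := fun y => ‖y - v‖) (by fun_prop) (v + k)
        ‖k‖ (by simp)).eventually (gt_mem_nhds hk)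
    filter_upwards [h1, h2, h3] with y h1 h2 h3
    have hy := hcone_of e a b (y - v) hba
    have : v + (y - v) ∈ poly.region := by
      rw [hy] at h3 ⊢
      exact hab _ _ (by positivity) (div_nonneg h2.le hba.le) h3
    simpa using this
  obtain ⟨t, ht0, -, ht⟩ := exists_small_pos_smul g hρ
  have hi1 : v + t • g ∈ interior poly.region := by
    refine hint (e := s) hT hq1 ?_ ?_ ht
    · rw [cross_smul_right, cross_swap g d]
      nlinarith
    · rw [cross_smul_right, cross_swap g P₂, hgP₂]
      nlinarith
  have hi2 : v - t • g ∈ interior poly.region := by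
    rw [sub_eq_add_neg]
    refine hint (e := -s) hT' ?_ ?_ ?_ (by rwa [norm_neg])
    · rw [cross_swap P₁ d']; linarith
    · rw [cross_neg_right, cross_smul_right]; nlinarith
    · rw [cross_neg_right, cross_smul_right, cross_swap g P₁, hgP₁]; nlinarith
  obtain ⟨m₁, hm₁, hs₁, hm₁P⟩ := hb.exists_notMem ρ hρ
  obtain ⟨m₂, hm₂, hs₂, hm₂P⟩ := hb'.exists_notMem ρ hρ
  have hA0 : s * cross d' P₂ ≤ 0 :=
    hb'.side_mul_cross_nonpos ((mem_feasibleRegion_iff.1 hp').2 x' hx')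
      (hlin.segment_subset (hb'.1 (right_mem_segment ℝ _ _))
        (feasibleRegion_subset_region hp') hq'5 (by simpa using hr))
  -- `m₁` and `m₂` lie outside the cone of the triangle `v p' x`
  have hout : ∀ m : Plane, ‖m‖ < ρ → v + m ∉ poly.region → ∃ A B : ℝ, m = A • P₂ - B • d ∧
      A = (s * cross d m) / (s * cross d P₂) ∧ (0 ≤ A → B < 0) := by
    intro m hm hmP
    have e := hcone_of s P₂ d m hq1
    refine ⟨_, _, e, rfl, fun hA => ?_⟩
    by_contra! hB
    exact hmP (by rw [e] at hm ⊢; exact hT _ _ hA hB hm)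
  have hf1 : 0 < -s * cross (t • g) m₁ := by
    obtain ⟨A, B, hm, hA, hAB⟩ := hout m₁ hm₁ hm₁P
    have hA0 : 0 < A := by rw [hA]; exact div_pos hs₁ hq1
    have hB := hAB hA0.le
    rw [hm, cross_smul_left, cross_sub_right, cross_smul_right, cross_smul_right, hgP₂]
    have h1 := mul_pos hA0 hpos
    have h2 := mul_pos_of_neg_of_neg hB hq2
    have h3 := mul_pos ht0 (add_pos h1 h2)
    linarith
  have hf2 : 0 < s * cross (t • g) m₂ := by
    obtain ⟨A, B, hm, -, hAB⟩ := hout m₂ hm₂ hm₂P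
    have hAX : 0 < A * (s * cross d' P₂) + B * (s * cross d d') := by
      rw [hm, cross_sub_right, cross_smul_right, cross_smul_right, cross_swap d d'] at hs₂
      linarith
    have hrel : (s * cross d P₂) * (s * cross g d')
        = (s * cross d' P₂) * (s * cross g d) - (s * cross d d') * (s * cross P₁ P₂) := by
      have : cross d P₂ * cross g d' = cross d' P₂ * cross g d + cross d d' * cross g P₂ := by
        simp only [cross]; ring
      rw [hgP₂] at this
      linear_combination s * s * this
    have hrel' := mul_neg_of_pos_of_neg hq1 hq'2
    have hA : A < 0 := by
      by_contra! hA
      have hB := hAB hA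
      have := mul_nonpos_of_nonneg_of_nonpos hA hA0
      have := mul_neg_of_neg_of_pos hB hq'3
      linarith
    have hgoal : 0 < -A * (s * cross P₁ P₂) - B * (s * cross g d) := by
      rcases le_or_gt 0 B with hB | hB
      · have h1 := mul_pos (neg_pos.2 hA) hpos
        have h2 := mul_nonpos_of_nonneg_of_nonpos hB hq2.le
        linarith
      · have h1 := mul_pos hAX (neg_pos.2 hq2)
        have h2 : (-A) * ((s * cross d P₂) * (s * cross g d')) < 0 :=
          mul_neg_of_pos_of_neg (neg_pos.2 hA) hrel'
        rw [hrel] at h2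
        have h3 : 0 < (s * cross d d') * (-A * (s * cross P₁ P₂) - B * (s * cross g d)) := by
          linarith
        exact pos_of_mul_pos_right h3 hq'3.le
    rw [hm, cross_smul_left, cross_sub_right, cross_smul_right, cross_smul_right, hgP₂]
    have h3 := mul_pos ht0 hgoal
    linarith
  obtain ⟨h1, -⟩ := rays_on_side (isClosed_region poly) hrays ht hm₁ hi1 hi2 hm₁P hf1
  obtain ⟨h2, -⟩ := rays_on_side (isClosed_region poly) hrays ht hm₂ hi1 hi2 hm₂P hf2
  linarith

lemma IsSupport.cross_eq_zero_of_isSupport (hpoly : poly.IsSimple) {i : Fin n}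
    (h : IsSupport poly S (poly i) σ p) (h' : IsSupport poly S (poly i) σ p')
    (hp : p ∈ poly.feasibleRegion S) (hp' : p' ∈ poly.feasibleRegion S)
    (hpv : ∀ j, p ≠ poly j) (hp'v : ∀ j, p' ≠ poly j) :
    cross (p - poly i) (p' - poly i) = 0 := by
  have h1 := h.side_mul_cross_nonpos_of_isSupport hpoly h' hp hp' hp'v
  have h2 := h'.side_mul_cross_nonpos_of_isSupport hpoly h hp' hp hpv
  rw [cross_swap (p - poly i) (p' - poly i)] at h2
  cases σ <;> simp only [side, if_true, Bool.false_eq_true, if_false] at h1 h2 <;> linarith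

end Uniqueness

/-! ### Points that are not vertices of the feasible region -/

lemma exists_side_mul_cross_pos {w : Plane} (hw : w ≠ 0) (τ : Bool) :
    ∃ k : Plane, 0 < side τ * cross w k := by
  obtain ⟨k, hk⟩ : ∃ k : Plane, cross w k ≠ 0 := by
    by_contra! h
    apply hw
    have h0 := h !₂[0, 1]
    have h1 := h !₂[1, 0]
    simp only [cross, Matrix.cons_val_zero, Matrix.cons_val_one] at h0 h1
    ext i
    fin_cases i
    · simpa using h0
    · simpa using h1
  obtain ⟨σ, hσ⟩ := exists_side_mul_pos hk
  by_cases h : σ = τ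
  · exact ⟨k, h ▸ hσ⟩
  · refine ⟨-k, ?_⟩
    rw [cross_neg_right]
    cases σ <;> cases τ <;> simp_all [side]

section Vertices

variable {n : ℕ} {poly : Polygon Plane n} {S : Set Plane} {p : Plane}

/-- If, near `p`, a closed set contains the line through `p` in direction `w` and, on each side of
it, all points or none, then `p` is not a vertex of the set. -/
lemma not_isVertexOf_of_line {A : Set Plane} (hA : IsClosed A) {w : Plane} (hw : w ≠ 0) {ρ : ℝ}
    (hρ : 0 < ρ) (hline : ∀ u : Plane, ‖u‖ < ρ → cross w u = 0 → p + u ∈ A)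
    (hside : ∀ τ, (∀ u : Plane, ‖u‖ < ρ → 0 < side τ * cross w u → p + u ∈ A) ∨
      ∀ u : Plane, ‖u‖ < ρ → 0 < side τ * cross w u → p + u ∉ A) : ¬ IsVertexOf A p := by
  rintro ⟨hfr, hno⟩
  rw [hA.frontier_eq] at hfr
  -- otherwise `p` is an inner point
  obtain ⟨τ, hτ⟩ : ∃ τ, ∀ u : Plane, ‖u‖ < ρ → 0 < side τ * cross w u → p + u ∉ A := by
    by_contra! hall
    apply hfr.2
    rw [mem_interior_iff_mem_nhds]
    filter_upwards [Metric.ball_mem_nhds p hρ] with y hy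
    have hy' := mem_ball_iff_norm.1 hy
    have e : p + (y - p) = y := by abel
    rw [← e]
    by_cases h0 : cross w (y - p) = 0
    · exact hline _ hy' h0
    · obtain ⟨τ, hτ⟩ := exists_side_mul_pos h0
      rcases hside τ with h | h
      · exact h _ hy' hτ
      · obtain ⟨u, hu1, hu2, hu3⟩ := hall τ
        exact absurd hu3 (h u hu1 hu2)
  refine hno ⟨w, hw, ?_⟩
  filter_upwards [Metric.ball_mem_nhds p hρ] with q hq
  have hq' := mem_ball_iff_norm.1 hq
  have e : p + (q - p) = q := by abel
  have hiff : (∃ t : ℝ, q = p + t • w) ↔ cross w (q - p) = 0 := by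
    rw [← exists_smul_iff_cross_eq_zero hw]
    simp only [sub_eq_iff_eq_add']
  rw [hiff, hA.frontier_eq]
  constructor
  · rintro ⟨hqA, hqi⟩
    by_contra h0
    obtain ⟨τ', hτ'⟩ := exists_side_mul_pos h0
    rcases hside τ' with h | h
    · apply hqi
      rw [mem_interior_iff_mem_nhds]
      have h1 : ∀ᶠ y in 𝓝 q, 0 < side τ' * cross w (y - p) :=
        (Continuous.tendsto (by fun_prop) q : Filter.Tendsto
          (fun y => side τ' * cross w (y - p)) (𝓝 q) _).eventually (lt_mem_nhds hτ')
      have h2 : ∀ᶠ y in 𝓝 q, ‖y - p‖ < ρ :=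
        (Continuous.tendsto (by fun_prop) q : Filter.Tendsto
          (fun y => ‖y - p‖) (𝓝 q) _).eventually (gt_mem_nhds hq')
      filter_upwards [h1, h2] with y h1 h2
      simpa using h _ h2 h1
    · exact h _ hq' hτ' (by rwa [e])
  · intro h0
    refine ⟨e ▸ hline _ hq' h0, fun hqi => ?_⟩
    rw [mem_interior_iff_mem_nhds] at hqi
    obtain ⟨k, hk⟩ := exists_side_mul_cross_pos hw τ
    have hlim : Filter.Tendsto (fun t : ℝ => q + t • k) (𝓝[>] 0) (𝓝 q) :=
      (Continuous.tendsto' (by fun_prop) 0 q (by simp)).mono_left nhdsWithin_le_nhds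
    have h1 : ∀ᶠ t : ℝ in 𝓝[>] 0, q + t • k ∈ A := hlim.eventually hqi
    have h2 : ∀ᶠ t : ℝ in 𝓝[>] 0, ‖q + t • k - p‖ < ρ :=
      (hlim.eventually (Metric.isOpen_ball.mem_nhds hq)).mono fun t ht => mem_ball_iff_norm.1 ht
    have h3 : ∀ᶠ t : ℝ in 𝓝[>] 0, 0 < t := self_mem_nhdsWithin
    obtain ⟨t, h1, h2, h3⟩ := (h1.and (h2.and h3)).exists
    refine hτ (q + t • k - p) h2 ?_ (by simpa using h1)
    have e2 : q + t • k - p = (q - p) + t • k := by abel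
    rw [e2, cross_add_right, h0, cross_smul_right, zero_add]
    have := mul_pos h3 hk
    linarith

/-- If the region is linear near a point `p` of the feasible region and all supporting lines at `p`
coincide with the distinguished line, then `p` is not a vertex. -/
lemma not_isVertexOf_of_isSupport (hpoly : poly.IsSimple) {w : Plane} {ρ : ℝ} {L R : Prop}
    (hw : w ≠ 0) (hρ : 0 < ρ) (hlin : IsLinearAt poly.region p ρ w L R)
    (hp : p ∈ poly.feasibleRegion S)
    (hsup : ∀ i σ, IsSupport poly S (poly i) σ p → cross w (p - poly i) = 0) :
    ¬ IsVertexOf (poly.feasibleRegion S) p := by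
  have hex : ∀ k : Fin n × Bool, ∃ ε > 0, ¬ IsSupport poly S (poly k.1) k.2 p →
      ∀ x ∈ S, ∀ q : Plane, ‖q - p‖ < ε → ¬ IsBlocking poly (poly k.1) k.2 x q := by
    intro k
    by_cases hk : IsSupport poly S (poly k.1) k.2 p
    · exact ⟨1, one_pos, fun h => absurd hk h⟩
    · have hk' := hk
      simp only [IsSupport] at hk'
      push Not at hk'
      obtain ⟨ε, hε, h⟩ := hk'
      exact ⟨ε, hε, fun _ => h⟩
  choose f hf0 hf using hex
  obtain ⟨ε, hε, hle⟩ := exists_pos_forall_le f hf0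
  -- nearby points outside the feasible region are cut off by a supporting line at `p`
  have key : ∀ u : Plane, ‖u‖ < min ρ ε → p + u ∈ poly.region → p + u ∉ poly.feasibleRegion S →
      ∃ i σ, IsSupport poly S (poly i) σ p ∧ 0 < side σ * cross (p - poly i) u := by
    intro u hu huP huF
    have : ∃ x ∈ S, ¬ segment ℝ x (p + u) ⊆ poly.region := by
      by_contra! hall
      exact huF (mem_feasibleRegion_iff.2 ⟨huP, hall⟩)
    obtain ⟨x, hx, hxu⟩ := this
    obtain ⟨i, σ, s, hs0, hs1, hb, hpos⟩ := exists_isBlocking hpoly hlin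
      (hu.trans_le (min_le_left _ _)) huP ((mem_feasibleRegion_iff.1 hp).2 x hx) hxu
    refine ⟨i, σ, ?_, hpos⟩
    by_contra hns
    refine hf (i, σ) hns x hx _ ?_ hb
    rw [add_sub_cancel_left, norm_smul, Real.norm_of_nonneg hs0]
    have h1 := hle (i, σ)
    have h2 := hu.trans_le (min_le_right _ _)
    nlinarith [norm_nonneg u]
  refine not_isVertexOf_of_line isClosed_feasibleRegion hw (lt_min hρ hε) (fun u hu h0 => ?_)
    (fun τ => ?_)
  · by_contra huF
    have huP : p + u ∈ poly.region := by
      rw [hlin u (hu.trans_le (min_le_left _ _)), h0]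
      exact ⟨fun h => absurd h (lt_irrefl _), fun h => absurd h (lt_irrefl _)⟩
    obtain ⟨i, σ, hs, hpos⟩ := key u hu huP huF
    obtain ⟨a, ha⟩ := exists_smul_of_cross_eq_zero hw (hsup i σ hs)
    rw [ha, cross_smul_left, h0, mul_zero, mul_zero] at hpos
    exact lt_irrefl _ hpos
  · by_contra! hc
    obtain ⟨⟨u₀, hu₀, hs₀, hF₀⟩, ⟨u₁, hu₁, hs₁, hF₁⟩⟩ := hc
    have hP₁ := (hlin u₁ (hu₁.trans_le (min_le_left _ _))).1 (feasibleRegion_subset_region hF₁)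
    have hP₀ : p + u₀ ∈ poly.region := by
      rw [hlin u₀ (hu₀.trans_le (min_le_left _ _))]
      cases τ <;> simp only [side, if_true, Bool.false_eq_true, if_false] at hs₀ hs₁
      · exact ⟨fun h => by linarith, fun _ => hP₁.2 (by linarith)⟩
      · exact ⟨fun _ => hP₁.1 (by linarith), fun h => by linarith⟩
    obtain ⟨i, σ, hs, hpos⟩ := key u₀ hu₀ hP₀ hF₀
    have hneg := hs.side_mul_cross_nonpos hlin hF₁ (by
      rw [add_sub_cancel_left]; exact hu₁.trans_le (min_le_left _ _))
    obtain ⟨a, ha⟩ := exists_smul_of_cross_eq_zero hw (hsup i σ hs)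
    rw [ha, cross_smul_left] at hpos hneg
    rw [add_sub_cancel_left] at hneg
    have h1 : 0 < (side σ * (a * cross w u₀)) * (side τ * cross w u₁) := mul_pos hpos hs₁
    have h2 : (side σ * (a * cross w u₁)) * (side τ * cross w u₀) ≤ 0 :=
      mul_nonpos_of_nonpos_of_nonneg hneg hs₀.le
    linarith

end Vertices

/-! ### Counting -/

/-- Three different points of a line cannot all be extreme in a set that contains them. -/
lemma eq_or_eq_or_eq_of_mem_extremePoints {K : Set Plane} {a b c : Plane}
    (hcol : Collinear ℝ {a, b, c}) (ha : a ∈ K.extremePoints ℝ) (hb : b ∈ K.extremePoints ℝ)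
    (hc : c ∈ K.extremePoints ℝ) : a = b ∨ a = c ∨ b = c := by
  have key : ∀ {a b c : Plane}, Wbtw ℝ a b c → a ∈ K.extremePoints ℝ → b ∈ K.extremePoints ℝ →
      c ∈ K.extremePoints ℝ → a = b ∨ b = c := by
    intro a b c h ha hb hc
    by_contra! hne
    exact hne.1 (hb.2 ha.1 hc.1
      (mem_openSegment_of_ne_left_right hne.1 hne.2.symm (mem_segment_iff_wbtw.2 h)))
  rcases hcol.wbtw_or_wbtw_or_wbtw with h | h | h
  · rcases key h ha hb hc with h | h <;> simp [h]
  · rcases key h hb hc ha with h | h <;> simp [h]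
  · rcases key h hc ha hb with h | h <;> simp [h]

/-- Double counting: if every point of `V` belongs to two members of a family of sets with at most
two elements each, then `V` has at most as many points as the family has members. -/
lemma finite_and_ncard_le_of_mem_two {ι X : Type*} [Fintype ι] {E : ι → Set X} {V : Set X}
    (hE : ∀ i, ∀ a ∈ E i, ∀ b ∈ E i, ∀ c ∈ E i, a = b ∨ a = c ∨ b = c)
    (hV : ∀ p ∈ V, ∃ i j, i ≠ j ∧ p ∈ E i ∧ p ∈ E j) :
    V.Finite ∧ V.ncard ≤ Fintype.card ι := by
  classical
  have key : ∀ s : Finset X, ↑s ⊆ V → s.card ≤ Fintype.card ι := by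
    intro s hs
    have := Finset.card_mul_le_card_mul (s := s) (t := Finset.univ) (m := 2) (n := 2)
      (fun p i => p ∈ E i) ?_ ?_
    · rw [Finset.card_univ] at this
      omega
    · intro p hp
      obtain ⟨i, j, hij, hi, hj⟩ := hV p (hs hp)
      refine Finset.one_lt_card.2 ⟨i, ?_, j, ?_, hij⟩ <;>
        simp [Finset.mem_bipartiteAbove, hi, hj]
    · intro i _
      by_contra! h
      obtain ⟨a, b, c, ha, hb, hc, hab, hac, hbc⟩ := Finset.two_lt_card_iff.1 h
      rw [Finset.mem_bipartiteBelow] at ha hb hc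
      rcases hE i a ha.2 b hb.2 c hc.2 with h | h | h
      · exact hab h
      · exact hac h
      · exact hbc h
  have hfin : V.Finite := by
    by_contra hinf
    obtain ⟨s, hs, hcard⟩ := Set.Infinite.exists_subset_card_eq hinf (Fintype.card ι + 1)
    have := key s hs
    omega
  refine ⟨hfin, ?_⟩
  rw [Set.ncard_eq_toFinset_card V hfin]
  exact key _ (by simp)

/-! ### The carriers of the boundary of the feasible region -/

section Carrier

variable {n : ℕ} (poly : Polygon Plane n) (S : Set Plane)

/-- The sets that carry the boundary of the feasible region: the feasible part of each edge, and,
for each polygon vertex and each side, the feasible points (other than polygon vertices) at which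
the polygon vertex supports the feasible region on that side. -/
def carrier : Fin n × Option Bool → Set Plane
  | (i, none) => poly.feasibleRegion S ∩ poly.edgeSet ℝ i
  | (i, some σ) => {p | p ∈ poly.feasibleRegion S ∧ (∀ j, p ≠ poly j) ∧
      IsSupport poly S (poly i) σ p}

variable {poly S}

lemma collinear_of_mem_carrier (hpoly : poly.IsSimple) {k : Fin n × Option Bool} {a b c : Plane}
    (ha : a ∈ carrier poly S k) (hb : b ∈ carrier poly S k) (hc : c ∈ carrier poly S k) :
    Collinear ℝ {a, b, c} := by
  rw [collinear_iff_exists_forall_eq_smul_vadd]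
  rcases k with ⟨i, _ | σ⟩
  · refine ⟨poly i, poly (finRotate n i) - poly i, ?_⟩
    have key : ∀ y ∈ carrier poly S (i, none),
        ∃ r : ℝ, y = r • (poly (finRotate n i) - poly i) +ᵥ poly i := by
      intro y hy
      have := hy.2
      rw [edgeSet_eq_segment, mem_segment_iff_exists_smul] at this
      obtain ⟨t, -, -, ht⟩ := this
      exact ⟨t, by rw [ht, vadd_eq_add, add_comm]⟩
    rintro y (rfl | rfl | rfl)
    exacts [key _ ha, key _ hb, key _ hc]
  · refine ⟨poly i, a - poly i, ?_⟩
    have key : ∀ y ∈ carrier poly S (i, some σ), ∃ r : ℝ, y = r • (a - poly i) +ᵥ poly i := by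
      intro y hy
      obtain ⟨r, hr⟩ := exists_smul_of_cross_eq_zero (sub_ne_zero.2 (ha.2.1 i))
        (ha.2.2.cross_eq_zero_of_isSupport hpoly hy.2.2 ha.1 hy.1 ha.2.1 hy.2.1)
      exact ⟨r, by rw [← hr, vadd_eq_add, sub_add_cancel]⟩
    rintro y (rfl | rfl | rfl)
    exacts [key _ ha, key _ hb, key _ hc]

lemma segment_subset_region_of_mem_carrier (hpoly : poly.IsSimple) {k : Fin n × Option Bool}
    {a b : Plane} (ha : a ∈ carrier poly S k) (hb : b ∈ carrier poly S k) :
    segment ℝ a b ⊆ poly.region := by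
  rcases k with ⟨i, _ | σ⟩
  · have ha' := ha.2
    have hb' := hb.2
    refine Set.Subset.trans ?_ (edgeSet_subset_region poly i)
    rw [edgeSet_eq_segment] at *
    exact (convex_segment _ _).segment_subset ha' hb'
  · refine (segment_subset_union_of_collinear (collinear_of_cross_eq_zero
      (ha.2.2.cross_eq_zero_of_isSupport hpoly hb.2.2 ha.1 hb.1 ha.2.1 hb.2.1))).trans ?_
    exact Set.union_subset ha.2.2.segment_subset hb.2.2.segment_subset

lemma carrier_subset_feasibleRegion {k : Fin n × Option Bool} :
    carrier poly S k ⊆ poly.feasibleRegion S := by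
  rcases k with ⟨i, _ | σ⟩ <;> exact fun y hy => hy.1

/-- A point of a carrier is extreme in it if some supporting line at the point does not contain
the carrier. -/
lemma mem_extremePoints_carrier (hpoly : poly.IsSimple) {k : Fin n × Option Bool} {p w v : Plane}
    {σ : Bool} (hp : p ∈ carrier poly S k) (hv : ∀ j, p ≠ poly j)
    (hk : ∀ a ∈ carrier poly S k, cross w (a - p) = 0) (hs : IsSupport poly S v σ p)
    (hw : cross w (p - v) ≠ 0) : p ∈ (carrier poly S k).extremePoints ℝ := by
  refine ⟨hp, fun a ha b hb hab => ?_⟩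
  have hpF := carrier_subset_feasibleRegion hp
  obtain ⟨ρ, hρ, w', L, R, -, hlin⟩ := exists_isLinearAt hpoly (feasibleRegion_subset_region hpF) hv
  have h0 := hs.cross_eq_zero_of_mem_openSegment hρ hlin hpF (carrier_subset_feasibleRegion ha)
    (carrier_subset_feasibleRegion hb) (segment_subset_region_of_mem_carrier hpoly hp ha)
    (segment_subset_region_of_mem_carrier hpoly hp hb) hab
  have hw0 : w ≠ 0 := by rintro rfl; exact hw (cross_zero_left _)
  obtain ⟨t, ht⟩ := exists_smul_of_cross_eq_zero hw0 (hk a ha)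
  rw [ht, cross_smul_right, cross_swap w] at h0
  have ht0 : t = 0 := (mul_eq_zero.1 h0).resolve_right (neg_ne_zero.2 hw)
  rw [ht0, zero_smul] at ht
  exact sub_eq_zero.1 ht

lemma cross_eq_zero_of_mem_carrier_some (hpoly : poly.IsSimple) {i : Fin n} {σ : Bool}
    {a p : Plane} (hp : p ∈ carrier poly S (i, some σ)) (ha : a ∈ carrier poly S (i, some σ)) :
    cross (p - poly i) (a - p) = 0 := by
  have e : a - p = (a - poly i) - (p - poly i) := by abel
  rw [e, cross_sub_right, cross_self, sub_zero]
  exact hp.2.2.cross_eq_zero_of_isSupport hpoly ha.2.2 hp.1 ha.1 hp.2.1 ha.2.1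

lemma vertex_mem_extremePoints_of_segment {K : Set Plane} {p z : Plane} (hzp : z - p ≠ 0)
    (hK : K ⊆ segment ℝ p z) (hp : p ∈ K) : p ∈ K.extremePoints ℝ := by
  refine ⟨hp, fun a ha b hb hab => ?_⟩
  obtain ⟨α, hα0, -, hα⟩ := mem_segment_iff_exists_smul.1 (hK ha)
  obtain ⟨β, hβ0, -, hβ⟩ := mem_segment_iff_exists_smul.1 (hK hb)
  obtain ⟨t, ht0, ht1, ht⟩ := mem_openSegment_iff_exists_smul.1 hab
  have e : ((1 - t) * α + t * β) • (z - p) = 0 := by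
    have : p + ((1 - t) * α + t * β) • (z - p) = a + t • (b - a) := by rw [hα, hβ]; module
    rw [← ht] at this
    simpa using this
  have h0 := (smul_eq_zero.1 e).resolve_right hzp
  have : α = 0 := by nlinarith [mul_nonneg ht0.le hβ0]
  rw [hα, this]; simp

/-- Every vertex of the feasible region is extreme in two of the carriers. -/
lemma exists_two_carriers_of_isVertexOf (hpoly : poly.IsSimple) {p : Plane}
    (hp : IsVertexOf (poly.feasibleRegion S) p) :
    ∃ k l, k ≠ l ∧ p ∈ (carrier poly S k).extremePoints ℝ ∧
      p ∈ (carrier poly S l).extremePoints ℝ := by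
  have hpF : p ∈ poly.feasibleRegion S := isClosed_feasibleRegion.frontier_subset hp.1
  have hpP := feasibleRegion_subset_region hpF
  by_cases hv : ∀ j, p ≠ poly j
  swap
  · push Not at hv
    obtain ⟨j, rfl⟩ := hv
    obtain ⟨i, rfl⟩ := (finRotate n).surjective j
    refine ⟨(finRotate n i, none), (i, none), ?_, ?_, ?_⟩
    · intro h
      exact finRotate_ne hpoly i (Prod.ext_iff.1 h).1
    · refine vertex_mem_extremePoints_of_segment (edge_direction_ne_zero hpoly _) ?_
        ⟨hpF, vertex_mem_edgeSet_left _⟩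
      rw [← edgeSet_eq_segment]
      exact Set.inter_subset_right
    · refine vertex_mem_extremePoints_of_segment (z := poly i) ?_ ?_
        ⟨hpF, vertex_mem_edgeSet_right _⟩
      · rw [← neg_sub]
        exact neg_ne_zero.2 (edge_direction_ne_zero hpoly i)
      · rw [segment_symm, ← edgeSet_eq_segment]
        exact Set.inter_subset_right
  by_cases hpi : p ∈ interior poly.region
  · have hsup : ∀ w : Plane, w ≠ 0 → ∃ i σ, IsSupport poly S (poly i) σ p ∧
        cross w (p - poly i) ≠ 0 := by
      intro w hw
      by_contra! hall
      obtain ⟨ρ, hρ, hlin⟩ := exists_isLinearAt_of_mem_interior hpi w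
      exact not_isVertexOf_of_isSupport hpoly hw hρ hlin hpF hall hp
    have i₀ : Fin n := ⟨0, by have := hpoly.three_le; omega⟩
    obtain ⟨i, σ, hs, -⟩ := hsup _ (edge_direction_ne_zero hpoly i₀)
    obtain ⟨j, τ, hs', hc⟩ := hsup _ (sub_ne_zero.2 (hv i))
    have hpi : p ∈ carrier poly S (i, some σ) := ⟨hpF, hv, hs⟩
    have hpj : p ∈ carrier poly S (j, some τ) := ⟨hpF, hv, hs'⟩
    refine ⟨(i, some σ), (j, some τ), ?_, ?_, ?_⟩
    · intro h
      have hij : i = j := (Prod.ext_iff.1 h).1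
      rw [hij] at hc
      exact hc (cross_self _)
    · exact mem_extremePoints_carrier hpoly hpi hv
        (fun a ha => cross_eq_zero_of_mem_carrier_some hpoly hpi ha) hs' hc
    · refine mem_extremePoints_carrier hpoly hpj hv
        (fun a ha => cross_eq_zero_of_mem_carrier_some hpoly hpj ha) hs ?_
      rw [cross_swap]
      exact neg_ne_zero.2 hc
  · have hpf : p ∈ frontier poly.region := by
      rw [(isClosed_region poly).frontier_eq]; exact ⟨hpP, hpi⟩
    obtain ⟨i, hi⟩ := (mem_boundary_iff poly).1 (frontier_region_subset poly hpf)
    obtain ⟨ρ, hρ, L, R, hlin⟩ := exists_isLinearAt_of_mem_edgeSet hpoly hi hv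
    have hw := edge_direction_ne_zero hpoly i
    obtain ⟨j, σ, hs, hc⟩ : ∃ j σ, IsSupport poly S (poly j) σ p ∧
        cross (poly (finRotate n i) - poly i) (p - poly j) ≠ 0 := by
      by_contra! hall
      exact not_isVertexOf_of_isSupport hpoly hw hρ hlin hpF hall hp
    have hpe : p ∈ carrier poly S (i, none) := ⟨hpF, hi⟩
    have hpj : p ∈ carrier poly S (j, some σ) := ⟨hpF, hv, hs⟩
    refine ⟨(i, none), (j, some σ), by simp, ?_, hpj, fun a ha b hb hab => ?_⟩
    · refine mem_extremePoints_carrier hpoly hpe hv (fun a ha => ?_) hs hc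
      have h1 := ha.2
      have h2 := hpe.2
      rw [edgeSet_eq_segment, mem_segment_iff_exists_smul] at h1 h2
      obtain ⟨t, -, -, ht⟩ := h1
      obtain ⟨t', -, -, ht'⟩ := h2
      have e : a - p = (t - t') • (poly (finRotate n i) - poly i) := by rw [ht, ht']; module
      rw [e, cross_smul_right, cross_self, mul_zero]
    · -- otherwise the region would contain both sides of the edge near `p`
      set w := poly (finRotate n i) - poly i
      by_contra hne
      have hTa := hlin.mem_of_segment_subset hρ
        (segment_subset_region_of_mem_carrier hpoly ha hpj)
      have hTb := hlin.mem_of_segment_subset hρ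
        (segment_subset_region_of_mem_carrier hpoly hb hpj)
      obtain ⟨κ, hκ⟩ := exists_smul_of_cross_eq_zero (sub_ne_zero.2 (hv j))
        (cross_eq_zero_of_mem_carrier_some hpoly hpj ha)
      have hca : cross w (a - p) ≠ 0 := by
        rw [hκ, cross_smul_right]
        refine mul_ne_zero ?_ hc
        rintro rfl
        rw [zero_smul] at hκ
        exact hne (sub_eq_zero.1 hκ)
      obtain ⟨t, ht0, ht1, ht⟩ := mem_openSegment_iff_exists_smul.1 hab
      have hsum : (1 - t) * cross w (a - p) + t * cross w (b - p) = 0 := by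
        have : (1 - t) • (a - p) + t • (b - p) = a + t • (b - a) - p := by module
        rw [← cross_smul_right, ← cross_smul_right, ← cross_add_right, this, ← ht, sub_self,
          cross_zero_right]
      have hLR : L ∧ R := by
        rcases lt_or_gt_of_ne hca with h | h
        · exact ⟨hTb.1 (by by_contra! h'; nlinarith), hTa.2 h⟩
        · exact ⟨hTa.1 h, hTb.2 (by by_contra! h'; nlinarith)⟩
      apply hpi
      rw [mem_interior_iff_mem_nhds]
      filter_upwards [Metric.ball_mem_nhds p hρ] with y hy
      have := (hlin (y - p) (mem_ball_iff_norm.1 hy)).2 ⟨fun _ => hLR.1, fun _ => hLR.2⟩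
      simpa using this

end Carrier

end PolygonVisibility

theorem mainTheorem8 (n : ℕ) (poly : Polygon Plane n) (hpoly : poly.IsSimple)
    (S : Set Plane) (hS : S ⊆ poly.region) :
    {p : Plane | IsVertexOf (poly.feasibleRegion S) p}.Finite ∧
      {p : Plane | IsVertexOf (poly.feasibleRegion S) p}.ncard ≤ 3 * n := by
  have h := PolygonVisibility.finite_and_ncard_le_of_mem_two
    (E := fun k => (PolygonVisibility.carrier poly S k).extremePoints ℝ)
    (V := {p : Plane | IsVertexOf (poly.feasibleRegion S) p})
    (fun k a ha b hb c hc => PolygonVisibility.eq_or_eq_or_eq_of_mem_extremePoints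
      (PolygonVisibility.collinear_of_mem_carrier hpoly ha.1 hb.1 hc.1) ha hb hc)
    (fun p hp => PolygonVisibility.exists_two_carriers_of_isVertexOf hpoly hp)
  simpa [mul_comm] using h
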